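/- **Model.** Let $\mathbb{B}^d$ be the closed Euclidean unit ball of $\mathbb{R}^d$. A *first-order oracle* of a convex function $F:\mathbb{B}^d\to\mathbb{R}$ that is $1$-Lipschitz for the Euclidean norm is the pair $(F,\mathbf g)$, where $\mathbf g$ assigns to each $\mathbf x\in\mathbb{B}^d$ a subgradient $\mathbf g(\mathbf x)\in\partial F(\mathbf x)$ (that is, $F(\mathbf y)\ge F(\mathbf x)+\langle \mathbf g(\mathbf x),\mathbf y-\mathbf x\rangle$ for all $\mathbf y\in\mathbb{B}^d$) with $\|\mathbf g(\mathbf x)\|_2\le 1$. An *$S$-bit, $T$-query deterministic algorithm* starts from a memory string $\mathbf M_0\in\{0,1\}^S$; in iteration $t=1,\dots,T$ it chooses a query $\mathbf x_t\in\mathbb{B}^d$ as a function of $t$ and $\mathbf M_{t-1}$, receives $F(\mathbf x_t)$ and $\mathbf g(\mathbf x_t)$, and sets $\mathbf M_t\in\{0,1\}^S$ as a function of $t$, $\mathbf M_{t-1}$, $F(\mathbf x_t)$ and $\mathbf g(\mathbf x_t)$; after iteration $T$ it outputs a point of $\mathbb{B}^d$ that is a function of $\mathbf M_T$. All these functions are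 arbitrary. An *$S$-bit, $T$-query randomized algorithm* is a probability distribution over $S$-bit, $T$-query deterministic algorithms. It *finds an $\epsilon$-optimal point with probability at least $p$* if for every $1$-Lipschitz convex $F:\mathbb{B}^d\to\mathbb{R}$ and every first-order oracle of $F$ as above, with probability at least $p$ its output $\hat{\mathbf x}$ satisfies $F(\hat{\mathbf x})-\min_{\mathbf x\in\mathbb{B}^d}F(\mathbf x)\le\epsilon$. **Theorem.** Let $\delta\in(0,1)$ be a constant, and put $\epsilon_d=\exp(-\log^5 d)$. 1. There are a constant $c>0$ and a sequence $\eta_d\to 0$ (both may depend on $\delta$) such that for every sufficiently large integer $d$ and all $S,T\in\mathbb{N}$: if some $S$-bit, $T$-query randomized algorithm finds an $\epsilon_d$-optimal point with probability at least $2/3$, then $$S\ \ge\ c\,d^{\,2-\delta}\qquad\text{or}\qquad T\ \ge\ c\,d^{\,1+\delta/6-\eta_d}.$$ That is, such an algorithm uses $\Omega(d^{2-\delta})$ bits of memory or makes $\Omega(d^{1+\delta/6-o(1)})$ queries. 2. Consequently, near-optimal query complexity needs near-quadratic memory: for every sequence $\beta_d\to0$ and every sufficiently large $d$, each $S$-bit,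 $T$-query randomized algorithm that finds an $\epsilon_d$-optimal point with probability at least $2/3$ and makes $T\le d^{1+\beta_d}$ queries (in particular, $T=\widetilde O(d)$ queries, as cutting-plane methods do) has $S\ge d^{\,2-\delta}$. In this sense the memory $\widetilde O(d^2)$ of cutting-plane methods cannot be improved polynomially, even with randomization, without a polynomial loss in the number of queries. -/

import Mathlib

open MeasureTheory Filter Topology

/-- The closed Euclidean unit ball of `ℝ^d`. -/
abbrev unitBall (d : ℕ) : Set (EuclideanSpace ℝ (Fin d)) := Metric.closedBall 0 1

/-- Memory contents of `S` bits. -/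
abbrev Memory (S : ℕ) : Type := Fin S → Bool

/-- `F` restricts to a convex function on the unit ball that is 1-Lipschitz for the Euclidean
norm. Values of `F` outside the ball play no role anywhere. -/
def IsConvexLipschitz {d : ℕ} (F : EuclideanSpace ℝ (Fin d) → ℝ) : Prop :=
  ConvexOn ℝ (unitBall d) F ∧ LipschitzOnWith 1 F (unitBall d)

/-- `g` is the subgradient part of a first-order oracle of `F` on the unit ball: at each point `x`
of the ball, `g x` is a subgradient of `F`, of norm at most the Lipschitz constant 1.
(In the interior of the ball the norm bound is automatic for a 1-Lipschitz `F`; on the boundary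
it excludes the arbitrarily long vectors that arise by adding outward normals of the ball.) -/
def IsSubgradientOracle {d : ℕ} (F : EuclideanSpace ℝ (Fin d) → ℝ)
    (g : EuclideanSpace ℝ (Fin d) → EuclideanSpace ℝ (Fin d)) : Prop :=
  ∀ x ∈ unitBall d, (∀ y ∈ unitBall d, F x + inner ℝ (g x) (y - x) ≤ F y) ∧ ‖g x‖ ≤ 1

/-- `x` minimizes `F` over the unit ball up to an additive error `ε`. -/
def IsEpsOptimal {d : ℕ} (F : EuclideanSpace ℝ (Fin d) → ℝ) (ε : ℝ)
    (x : EuclideanSpace ℝ (Fin d)) : Prop :=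
  x ∈ unitBall d ∧ ∀ y ∈ unitBall d, F x - F y ≤ ε

/-- A deterministic first-order algorithm with `S` bits of memory and `T` queries. The query of
each iteration depends on the memory only; the memory is then updated from its former
contents, the value and the subgradient. No restriction (computability, measurability, precision)
is put on the maps, and they may differ from one iteration to the next. -/
structure DetAlgorithm (d S T : ℕ) where
  /-- the initial memory -/
  init : Memory S
  /-- the query of iteration `t`, as a function of the memory -/
  query : Fin T → Memory S → unitBall d
  /-- the memory after iteration `t`, from the memory before it, the value and the subgradient -/
  update : Fin T → Memory S → ℝ → EuclideanSpace ℝ (Fin d) → Memory S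
  /-- the output, as a function of the final memory -/
  output : Memory S → unitBall d

namespace DetAlgorithm

variable {d S T : ℕ}

/-- The memory after `t` iterations (constant from `t = T` on) with oracle `(F, g)`. -/
def memory (A : DetAlgorithm d S T) (F : EuclideanSpace ℝ (Fin d) → ℝ)
    (g : EuclideanSpace ℝ (Fin d) → EuclideanSpace ℝ (Fin d)) : ℕ → Memory S
  | 0 => A.init
  | t + 1 =>
    if h : t < T then
      A.update ⟨t, h⟩ (A.memory F g t)
        (F (A.query ⟨t, h⟩ (A.memory F g t))) (g (A.query ⟨t, h⟩ (A.memory F g t)))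
    else A.memory F g t

/-- The output after `T` iterations with oracle `(F, g)`. -/
def run (A : DetAlgorithm d S T) (F : EuclideanSpace ℝ (Fin d) → ℝ)
    (g : EuclideanSpace ℝ (Fin d) → EuclideanSpace ℝ (Fin d)) : EuclideanSpace ℝ (Fin d) :=
  A.output (A.memory F g T)

end DetAlgorithm

/-- A randomized `S`-bit, `T`-query algorithm: a probability distribution, for an arbitrary
σ-algebra, over deterministic `S`-bit, `T`-query algorithms. -/
structure RandAlgorithm (d S T : ℕ) where
  /-- the σ-algebra -/
  mspace : MeasurableSpace (DetAlgorithm d S T)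
  /-- the distribution -/
  law : @Measure (DetAlgorithm d S T) mspace
  /-- it has total mass one -/
  isProb : @IsProbabilityMeasure (DetAlgorithm d S T) mspace law

/-- The randomized algorithm finds an `ε`-optimal point with probability at least `p`: this holds
for each 1-Lipschitz convex `F` and each first-order oracle of `F`. (The event of success contains
a measurable event of probability at least `p`; when it is measurable itself, this says that its
probability is at least `p`.) -/
def RandAlgorithm.FindsEpsOptimal {d S T : ℕ} (R : RandAlgorithm d S T) (ε p : ℝ) : Prop :=
  ∀ (F : EuclideanSpace ℝ (Fin d) → ℝ) (g : EuclideanSpace ℝ (Fin d) → EuclideanSpace ℝ (Fin d)),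
    IsConvexLipschitz F → IsSubgradientOracle F g →
      ∃ E : Set (DetAlgorithm d S T), MeasurableSet[R.mspace] E ∧
        (∀ A ∈ E, IsEpsOptimal F ε (A.run F g)) ∧ ENNReal.ofReal p ≤ R.law E

/-!
The proof exhibits a finite family of functions on which every deterministic algorithm with little
memory and few queries fails often; averaging over its random choice then defeats a randomized one
(`RandAlgorithm.FindsEpsOptimal.exists_detAlgorithm`).

An instance consists of a matrix `A` with `n ≈ d / 4` rows of bounded natural numbers and of keys
`v_0, …, v_B`, which are sign vectors. Its function is the maximum of `± ⟪a_r, x⟫ / (N d) - 3 s`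
over the rows and of `s (⟪v_j, x⟫ - j γ)` over the keys, and the oracle answers by the first maximal
piece. A key that is not yet seen is nearly orthogonal to the queries, so the keys are met in their
order, and an optimal point requires that all of them have been met. A query that is answered by
key `i + 1` is correlated with key `i` and nearly orthogonal to all rows of `A`
(`le_two_mul_card_of_isEpsOptimal`). With fewer than about `B n` queries, some key `i` is passed
within `n / 2` queries. So at least `b` rows are not met between the moment at which key `i` is
revealed and the moment at which such a query is made.

This needs memory (`card_mul_pow_le_of_cell_sampling`). The memory `M` at the moment at which key `i`
is revealed does not depend on `v_i`. So the rest of the phase can be replayed, from `M` and without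
the unmet rows, for all values of `v_i`, and yields points `x(v)` that are correlated with `v` and
nearly orthogonal to the unmet rows. A fixed subspace of small dimension contains no point correlated
with a typical `v` (`card_le_norm_proj_signVec_le`), so `2 k₀` values of `v` can be chosen whose
points are robustly independent. A row of naturals below `N` that is nearly orthogonal to all of these
points is confined to a fraction `N ^ (-k₀)` of the possible rows
(`RobustlyIndependent.card_nearly_orthogonal_le`), hence all unmet rows together to a fraction
`N ^ (-k₀ b)`. As `M` takes only `2 ^ S` values, `S` is at least of order `k₀ b`.

The correlation `θ` is about `√(b log d / d)` with `b = k₀ ≈ d ^ (1 - δ / 2)`, so that typical keys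
defeat subspaces of dimension `2 k₀`. The optimal value is about `- s / √B`, which has to
dominate the delays `B γ ≈ B θ` of the keys. This allows `B ≈ d ^ (δ / 6) / log d` keys, and `B n`
queries.
-/

/-! ### Projections of random sign vectors -/

/-- The sign vector `(±1, …, ±1) / √d` given by `v`; it is a unit vector for `d > 0`. -/
noncomputable def signVec {d : ℕ} (v : Fin d → Bool) : EuclideanSpace ℝ (Fin d) :=
  WithLp.toLp 2 fun i => (if v i then 1 else -1) / √(d : ℝ)

lemma norm_signVec {d : ℕ} (hd : 0 < d) (v : Fin d → Bool) : ‖signVec v‖ = 1 := by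
  rw [EuclideanSpace.norm_eq, Real.sqrt_eq_one]
  have h : ∀ i : Fin d, ‖signVec v i‖ ^ 2 = 1 / d := by
    intro i
    have h1 : (if v i then (1 : ℝ) else -1) ^ 2 = 1 := by split_ifs <;> norm_num
    simp only [signVec, Real.norm_eq_abs, sq_abs, div_pow, h1, Real.sq_sqrt (Nat.cast_nonneg d)]
  simp only [h, Finset.sum_const, Finset.card_univ, Fintype.card_fin, nsmul_eq_mul]
  have : (d : ℝ) ≠ 0 := by positivity
  field_simp

lemma norm_signVec_le {d : ℕ} (v : Fin d → Bool) : ‖signVec v‖ ≤ 1 := by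
  rcases Nat.eq_zero_or_pos d with rfl | hd
  · simp [Subsingleton.elim (signVec v) 0]
  · exact (norm_signVec hd v).le

lemma exp_sq_div_four_eq_integral (y : ℝ) :
    Real.exp (y ^ 2 / 4) = ∫ s, Real.exp (y / √2 * s) ∂ProbabilityTheory.gaussianReal 0 1 := by
  have h := ProbabilityTheory.mgf_gaussianReal (p := ProbabilityTheory.gaussianReal 0 1)
    (X := id) (μ := 0) (v := 1) (by simp) (y / √2)
  simp only [ProbabilityTheory.mgf, id] at h
  rw [h]
  congr 1
  rw [div_pow, Real.sq_sqrt (by norm_num)]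
  simp
  ring

lemma integrable_exp_sq_div_four :
    Integrable (fun s : ℝ => Real.exp (s ^ 2 / 4)) (ProbabilityTheory.gaussianReal 0 1) := by
  rw [ProbabilityTheory.gaussianReal_of_var_ne_zero _ one_ne_zero,
    integrable_withDensity_iff_integrable_smul' (by fun_prop) (by simp [ProbabilityTheory.gaussianPDF])]
  have : (fun x : ℝ => (ProbabilityTheory.gaussianPDF 0 1 x).toReal • Real.exp (x ^ 2 / 4))
      = fun x => (√(2 * Real.pi))⁻¹ * Real.exp (-(1 / 4) * x ^ 2) := by
    ext x
    rw [ProbabilityTheory.toReal_gaussianPDF, ProbabilityTheory.gaussianPDFReal, smul_eq_mul,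
      mul_assoc, ← Real.exp_add]
    simp only [NNReal.coe_one, mul_one]
    congr 2
    ring
  rw [this]
  exact (integrable_exp_neg_mul_sq (by norm_num)).const_mul _

lemma integral_exp_sq_div_four :
    ∫ s, Real.exp (s ^ 2 / 4) ∂ProbabilityTheory.gaussianReal 0 1 = √2 := by
  rw [ProbabilityTheory.integral_gaussianReal_eq_integral_smul one_ne_zero]
  have : (fun x : ℝ => ProbabilityTheory.gaussianPDFReal 0 1 x • Real.exp (x ^ 2 / 4))
      = fun x => (√(2 * Real.pi))⁻¹ * Real.exp (-(1 / 4) * x ^ 2) := by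
    ext x
    rw [ProbabilityTheory.gaussianPDFReal, smul_eq_mul, mul_assoc, ← Real.exp_add]
    simp only [NNReal.coe_one, mul_one]
    congr 2
    ring
  rw [this, integral_const_mul, integral_gaussian, ← Real.sqrt_inv, ← Real.sqrt_mul (by positivity)]
  congr 1
  have := Real.pi_ne_zero
  field_simp
  norm_num

lemma sum_exp_sign_le {d : ℕ} (c : Fin d → ℝ) :
    ∑ v : Fin d → Bool, Real.exp (∑ i, (if v i then 1 else -1) * c i) ≤
      2 ^ d * Real.exp ((∑ i, c i ^ 2) / 2) := by
  have h1 : ∑ v : Fin d → Bool, Real.exp (∑ i, (if v i then 1 else -1) * c i)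
      = ∏ i, ∑ b : Bool, Real.exp ((if b then 1 else -1) * c i) := by
    rw [Finset.prod_univ_sum]
    simp only [Fintype.piFinset_univ, Real.exp_sum]
  rw [h1, Finset.sum_div, Real.exp_sum]
  have h2 : (2 : ℝ) ^ d = ∏ _i : Fin d, (2 : ℝ) := by simp
  rw [h2, ← Finset.prod_mul_distrib]
  refine Finset.prod_le_prod (fun i _ => by positivity) fun i _ => ?_
  have := Real.cosh_le_exp_half_sq (c i)
  rw [Real.cosh_eq] at this
  simp only [Fintype.sum_bool, if_true, one_mul, Bool.false_eq_true, if_false, neg_mul]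
  linarith

/-- Exponential moment of the squared projection of a random sign vector. The square is
linearized by a Gaussian integral, so that the signs decouple. -/
lemma sum_exp_orthonormal_le {d r : ℕ} (hd : 0 < d) (u : Fin r → EuclideanSpace ℝ (Fin d))
    (hu : Orthonormal ℝ u) :
    ∑ v : Fin d → Bool, Real.exp (d / 4 * ∑ j, inner ℝ (u j) (signVec v) ^ 2) ≤
      2 ^ d * √2 ^ r := by
  set γ := ProbabilityTheory.gaussianReal 0 1
  let y : (Fin d → Bool) → Fin r → ℝ := fun v j => ∑ i, (if v i then 1 else -1) * u j i
  have hy : ∀ v j, (d : ℝ) * inner ℝ (u j) (signVec v) ^ 2 = y v j ^ 2 := by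
    intro v j
    have h1 : inner ℝ (u j) (signVec v) = y v j / √d := by
      simp only [PiLp.inner_apply, y, signVec, Finset.sum_div]
      refine Finset.sum_congr rfl fun i _ => ?_
      split_ifs <;> simp <;> ring
    rw [h1, div_pow, Real.sq_sqrt (Nat.cast_nonneg d)]
    have : (d : ℝ) ≠ 0 := by positivity
    field_simp
  have h1 : ∀ v, Real.exp (d / 4 * ∑ j, inner ℝ (u j) (signVec v) ^ 2)
      = ∫ s : Fin r → ℝ, ∏ j, Real.exp (y v j / √2 * s j) ∂Measure.pi fun _ => γ := by
    intro v
    rw [integral_fintype_prod_eq_prod (fun j s => Real.exp (y v j / √2 * s))]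
    simp only [γ, ← exp_sq_div_four_eq_integral]
    rw [← Real.exp_sum, Finset.mul_sum]
    congr 1
    refine Finset.sum_congr rfl fun j _ => ?_
    rw [← hy]
    ring
  have hint : ∀ v, Integrable (fun s : Fin r → ℝ => ∏ j, Real.exp (y v j / √2 * s j))
      (Measure.pi fun _ => γ) := fun v =>
    Integrable.fintype_prod (f := fun j s => Real.exp (y v j / √2 * s))
      fun j => ProbabilityTheory.integrable_exp_mul_gaussianReal _
  simp only [h1]
  rw [← integral_finsetSum _ fun v _ => hint v]
  have hpt : ∀ s : Fin r → ℝ, ∑ v, ∏ j, Real.exp (y v j / √2 * s j) ≤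
      2 ^ d * ∏ j, Real.exp (s j ^ 2 / 4) := by
    intro s
    have h2 : ∀ v : Fin d → Bool, ∏ j, Real.exp (y v j / √2 * s j)
        = Real.exp (∑ i, (if v i then 1 else -1) * ((∑ j, s j • u j) i / √2)) := by
      intro v
      rw [← Real.exp_sum]
      congr 1
      simp only [y, Finset.sum_div, Finset.sum_mul, WithLp.ofLp_sum, Finset.sum_apply,
        WithLp.ofLp_smul, Pi.smul_apply, smul_eq_mul, Finset.mul_sum]
      rw [Finset.sum_comm]
      refine Finset.sum_congr rfl fun i _ => Finset.sum_congr rfl fun j _ => ?_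
      ring
    simp only [h2]
    refine (sum_exp_sign_le _).trans_eq ?_
    congr 1
    rw [← Real.exp_sum]
    congr 1
    have h3 : ∑ i, (∑ j, s j • u j : EuclideanSpace ℝ (Fin d)) i ^ 2 = ∑ j, s j ^ 2 := by
      rw [← EuclideanSpace.real_norm_sq_eq, ← real_inner_self_eq_norm_sq, hu.inner_sum]
      simp [sq]
    simp only [div_pow, Real.sq_sqrt (by norm_num : (0 : ℝ) ≤ 2)]
    rw [← Finset.sum_div, h3, ← Finset.sum_div]
    ring
  have hint2 : Integrable (fun s : Fin r → ℝ => ∏ j, Real.exp (s j ^ 2 / 4))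
      (Measure.pi fun _ => γ) :=
    Integrable.fintype_prod (f := fun _ s => Real.exp (s ^ 2 / 4))
      fun _ => integrable_exp_sq_div_four
  refine (integral_mono (integrable_finsetSum _ fun v _ => hint v) (hint2.const_mul _)
    hpt).trans_eq ?_
  rw [integral_const_mul, integral_fintype_prod_eq_prod (fun _ s => Real.exp (s ^ 2 / 4))]
  simp [γ, integral_exp_sq_div_four]

/-- A random sign vector rarely has a large projection on a fixed subspace of small dimension. -/
theorem card_le_norm_proj_signVec_le {d : ℕ} (hd : 0 < d)
    (U : Submodule ℝ (EuclideanSpace ℝ (Fin d))) {r : ℕ} (hr : Module.finrank ℝ U ≤ r)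
    {t : ℝ} (ht : 0 ≤ t) :
    ((Finset.univ.filter fun v : Fin d → Bool => t ≤ ‖U.starProjection (signVec v)‖).card : ℝ) ≤
      √2 ^ r * Real.exp (-(d * t ^ 2 / 4)) * 2 ^ d := by
  classical
  set e := stdOrthonormalBasis ℝ U
  have hu : Orthonormal ℝ fun j => (e j : EuclideanSpace ℝ (Fin d)) :=
    e.orthonormal.comp_linearIsometry U.subtypeₗᵢ
  have hn : ∀ x, ‖U.starProjection x‖ ^ 2 = ∑ j, inner ℝ (e j : EuclideanSpace ℝ (Fin d)) x ^ 2 := by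
    intro x
    change ‖U.orthogonalProjectionOnto x‖ ^ 2 = _
    rw [← e.sum_sq_norm_inner_right]
    refine Finset.sum_congr rfl fun j _ => ?_
    rw [Real.norm_eq_abs, sq_abs]
    congr 1
    exact U.inner_orthogonalProjectionOnto_eq_of_mem_left _ _
  have h1 := sum_exp_orthonormal_le hd _ hu
  simp only [← hn] at h1
  have h2 : ((Finset.univ.filter fun v : Fin d → Bool =>
        t ≤ ‖U.starProjection (signVec v)‖).card : ℝ) * Real.exp (d * t ^ 2 / 4) ≤
      ∑ v : Fin d → Bool, Real.exp (d / 4 * ‖U.starProjection (signVec v)‖ ^ 2) := by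
    rw [← nsmul_eq_mul, ← Finset.sum_const]
    refine (Finset.sum_le_sum fun v hv => ?_).trans
      (Finset.sum_le_sum_of_subset_of_nonneg (Finset.filter_subset _ _) fun _ _ _ => by positivity)
    rw [Finset.mem_filter] at hv
    rw [Real.exp_le_exp]
    have : t ^ 2 ≤ ‖U.starProjection (signVec v)‖ ^ 2 := by gcongr; exact hv.2
    have hd' : (0 : ℝ) ≤ d / 4 := by positivity
    nlinarith
  have h3 : √2 ^ Module.finrank ℝ U ≤ √2 ^ r := by
    gcongr
    rw [Real.one_le_sqrt]; norm_num
  rw [Real.exp_neg]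
  have h4 := h2.trans h1
  have hpos := Real.exp_pos (d * t ^ 2 / 4)
  rw [← le_div_iff₀ hpos] at h4
  refine h4.trans ?_
  rw [div_eq_mul_inv, mul_comm (2 ^ d : ℝ), mul_right_comm]
  gcongr

/-! ### Integer vectors nearly orthogonal to a robustly independent family -/

/-- Each vector of the family has distance at least `ρ` from the span of the earlier ones. -/
def RobustlyIndependent {d k : ℕ} (ρ : ℝ) (x : Fin k → EuclideanSpace ℝ (Fin d)) : Prop :=
  ∀ j : Fin k, ∀ y ∈ Submodule.span ℝ (x '' {l | l < j}), ρ ≤ ‖x j - y‖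

lemma RobustlyIndependent.init {d k : ℕ} {ρ : ℝ} {x : Fin (k + 1) → EuclideanSpace ℝ (Fin d)}
    (h : RobustlyIndependent ρ x) : RobustlyIndependent ρ (fun i : Fin k => x i.castSucc) := by
  intro j y hy
  refine h j.castSucc y (Submodule.span_mono ?_ hy)
  rintro _ ⟨l, hl, rfl⟩
  exact ⟨l.castSucc, by simpa using hl, rfl⟩

lemma EuclideanSpace.exists_norm_le_sqrt_mul_abs {d : ℕ} (hd : 0 < d)
    (x : EuclideanSpace ℝ (Fin d)) : ∃ i, ‖x‖ ≤ √d * |x i| := by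
  have : Nonempty (Fin d) := ⟨⟨0, hd⟩⟩
  obtain ⟨i, hi⟩ := Finite.exists_max fun i => |x i|
  refine ⟨i, ?_⟩
  rw [EuclideanSpace.norm_eq]
  have : ∑ j, ‖x j‖ ^ 2 ≤ d * |x i| ^ 2 := by
    calc ∑ j, ‖x j‖ ^ 2 ≤ ∑ _j : Fin d, |x i| ^ 2 :=
          Finset.sum_le_sum fun j _ => by
            rw [Real.norm_eq_abs]; exact pow_le_pow_left₀ (abs_nonneg _) (hi j) 2
      _ = _ := by simp
  calc √(∑ j, ‖x j‖ ^ 2) ≤ √(d * |x i| ^ 2) := Real.sqrt_le_sqrt this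
    _ = _ := by rw [Real.sqrt_mul (by positivity), Real.sqrt_sq (abs_nonneg _)]

/-- A robustly independent family has a large maximal minor. In the expansion along the last
column, the minor is a coordinate of a vector `∑ c_l x_l` whose last coefficient is the minor
chosen before; so this vector is long. -/
lemma RobustlyIndependent.exists_le_abs_det {d : ℕ} (hd : 0 < d) {ρ : ℝ} (hρ : 0 ≤ ρ) :
    ∀ {k : ℕ} {x : Fin k → EuclideanSpace ℝ (Fin d)}, RobustlyIndependent ρ x →
      ∃ g : Fin k → Fin d, (ρ / √d) ^ k ≤ |(Matrix.of fun a b => x a (g b)).det| := by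
  intro k
  induction k with
  | zero => intro x _; exact ⟨Fin.elim0, by simp⟩
  | succ k ih =>
    intro x hx
    obtain ⟨g, hg⟩ := ih hx.init
    set M0 : Matrix (Fin k) (Fin k) ℝ := Matrix.of fun a b => x a.castSucc (g b) with hM0
    let c : Fin (k + 1) → ℝ := fun a => (-1) ^ ((a : ℕ) + k) *
      (Matrix.of fun (a' b : Fin k) => x (a.succAbove a') (g b)).det
    have hdet : ∀ i : Fin d, (Matrix.of fun a b : Fin (k + 1) =>
        x a ((Fin.snoc g i : Fin (k + 1) → Fin d) b)).det = (∑ a, c a • x a) i := by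
      intro i
      rw [Matrix.det_succ_column _ (Fin.last k)]
      simp only [WithLp.ofLp_sum, Finset.sum_apply, WithLp.ofLp_smul, Pi.smul_apply, smul_eq_mul]
      refine Finset.sum_congr rfl fun a _ => ?_
      simp only [c, Matrix.of_apply, Fin.snoc_last, Fin.val_last]
      have : ((Matrix.of fun a b : Fin (k + 1) =>
          x a ((Fin.snoc g i : Fin (k + 1) → Fin d) b)).submatrix a.succAbove
            (Fin.last k).succAbove) = Matrix.of fun (a' b : Fin k) => x (a.succAbove a') (g b) := by
        ext a' b
        simp [Fin.succAbove_last]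
      rw [this]
      ring
    have hclast : |c (Fin.last k)| = |M0.det| := by
      simp only [c, Fin.succAbove_last, abs_mul, abs_pow, abs_neg, abs_one, one_pow, one_mul, hM0]
    have hnorm : |M0.det| * ρ ≤ ‖∑ a, c a • x a‖ := by
      rcases eq_or_ne M0.det 0 with h0 | h0
      · simp [h0]
      · have hc0 : c (Fin.last k) ≠ 0 := by
          rw [← abs_pos, hclast]; exact abs_pos.mpr h0
        have hy : -∑ a : Fin k, ((c (Fin.last k))⁻¹ * c a.castSucc) • x a.castSucc ∈
            Submodule.span ℝ (x '' {l | l < Fin.last k}) := by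
          refine Submodule.neg_mem _ (Submodule.sum_mem _ fun a _ => Submodule.smul_mem _ _ ?_)
          exact Submodule.subset_span ⟨a.castSucc, Fin.castSucc_lt_last a, rfl⟩
        have h1 := hx (Fin.last k) _ hy
        have h2 : ∑ a, c a • x a = c (Fin.last k) • (x (Fin.last k) -
            -∑ a : Fin k, ((c (Fin.last k))⁻¹ * c a.castSucc) • x a.castSucc) := by
          rw [Fin.sum_univ_castSucc, sub_neg_eq_add, smul_add, Finset.smul_sum, add_comm]
          congr 1
          refine Finset.sum_congr rfl fun a _ => ?_
          rw [smul_smul, mul_inv_cancel_left₀ hc0]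
        rw [h2, norm_smul, Real.norm_eq_abs, hclast]
        gcongr
    obtain ⟨i, hi⟩ := EuclideanSpace.exists_norm_le_sqrt_mul_abs hd (∑ a, c a • x a)
    refine ⟨Fin.snoc g i, ?_⟩
    rw [hdet]
    have hs : 0 < √(d : ℝ) := Real.sqrt_pos.mpr (by positivity)
    rw [pow_succ, mul_div_assoc', div_le_iff₀ hs]
    calc (ρ / √d) ^ k * ρ ≤ |M0.det| * ρ := by gcongr
      _ ≤ _ := hnorm
      _ ≤ _ := hi
      _ = _ := mul_comm _ _

/-- The largest absolute value of an `r × r` minor of the matrix with rows `x`. -/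
noncomputable def maxMinor {d k : ℕ} (x : Fin k → EuclideanSpace ℝ (Fin d)) (r : ℕ) : ℝ :=
  ⨆ p : (Fin r → Fin k) × (Fin r → Fin d), |(Matrix.of fun a b => x (p.1 a) (p.2 b)).det|

lemma abs_det_le_maxMinor {d k r : ℕ} (x : Fin k → EuclideanSpace ℝ (Fin d))
    (f : Fin r → Fin k) (g : Fin r → Fin d) :
    |(Matrix.of fun a b => x (f a) (g b)).det| ≤ maxMinor x r :=
  le_ciSup (f := fun p : (Fin r → Fin k) × (Fin r → Fin d) =>
    |(Matrix.of fun a b => x (p.1 a) (p.2 b)).det|) (Set.finite_range _).bddAbove (f, g)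

lemma maxMinor_nonneg {d k r : ℕ} (x : Fin k → EuclideanSpace ℝ (Fin d)) : 0 ≤ maxMinor x r :=
  Real.iSup_nonneg fun _ => abs_nonneg _

lemma maxMinor_le {d k r : ℕ} (x : Fin k → EuclideanSpace ℝ (Fin d)) (hx : ∀ j, ‖x j‖ ≤ 1)
    (hr : r ≤ d) : maxMinor x r ≤ (d : ℝ) ^ r := by
  refine Real.iSup_le (fun p => ?_) (by positivity)
  have h := Matrix.det_le (A := Matrix.of fun a b => x (p.1 a) (p.2 b))
    (abv := AbsoluteValue.abs) (x := (1 : ℝ)) fun a b => by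
      simpa using (PiLp.norm_apply_le (x (p.1 a)) (p.2 b)).trans (hx _)
  simp only [Fintype.card_fin, one_pow, nsmul_eq_mul, mul_one, AbsoluteValue.abs_apply] at h
  refine h.trans ?_
  have : r.factorial ≤ d ^ r := (Nat.factorial_le_pow r).trans (Nat.pow_le_pow_left hr r)
  exact_mod_cast this

/-- Among the minors of a robustly independent family there is one, of large size, whose ratio to
all minors of one size less is bounded below: the maximal minors cannot drop at each size. -/
lemma RobustlyIndependent.exists_maxMinor_ratio {d k₀ : ℕ} (hd : 0 < d) (hk : k₀ ≤ d) {ρ σ : ℝ}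
    (hρ : 0 < ρ) (hσ : 0 < σ) (hσρ : σ * d ^ 2 < ρ ^ 2) {x : Fin (k₀ + k₀) → EuclideanSpace ℝ (Fin d)}
    (hx : RobustlyIndependent ρ x) (hx1 : ∀ j, ‖x j‖ ≤ 1) (hk0 : 0 < k₀) :
    ∃ r, k₀ ≤ r ∧ r < k₀ + k₀ ∧ 0 < maxMinor x (r + 1) ∧
      σ * maxMinor x r ≤ maxMinor x (r + 1) := by
  by_contra! hcon
  have hd' : (0 : ℝ) < d := by positivity
  have key : ∀ i, i ≤ k₀ → maxMinor x (k₀ + i) ≤ σ ^ i * maxMinor x k₀ := by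
    intro i
    induction i with
    | zero => intro _; simp
    | succ i ih =>
      intro hi
      have h1 := ih (by omega)
      have h2 : maxMinor x (k₀ + i + 1) ≤ σ * maxMinor x (k₀ + i) := by
        rcases (maxMinor_nonneg x (r := k₀ + i + 1)).lt_or_eq with h | h
        · exact (hcon (k₀ + i) (by omega) (by omega) h).le
        · rw [← h]; exact mul_nonneg hσ.le (maxMinor_nonneg x)
      calc maxMinor x (k₀ + (i + 1)) ≤ σ * maxMinor x (k₀ + i) := h2
        _ ≤ σ * (σ ^ i * maxMinor x k₀) := by gcongr
        _ = _ := by ring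
  obtain ⟨g, hg⟩ := hx.exists_le_abs_det hd hρ.le
  have h1 := hg.trans (abs_det_le_maxMinor x id g)
  have h2 := h1.trans (key k₀ le_rfl)
  have h3 : σ ^ k₀ * maxMinor x k₀ ≤ (σ * d) ^ k₀ := by
    rw [mul_pow]; gcongr; exact maxMinor_le x hx1 hk
  have h4 : (ρ / √d) ^ (k₀ + k₀) = (ρ ^ 2 / d) ^ k₀ := by
    rw [← two_mul, pow_mul, div_pow, Real.sq_sqrt hd'.le]
  rw [h4] at h2
  have h5 : (σ * d) ^ k₀ < (ρ ^ 2 / d) ^ k₀ := by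
    refine pow_lt_pow_left₀ ?_ (by positivity) hk0.ne'
    rw [lt_div_iff₀ hd']
    nlinarith
  linarith

/-- Few integer points of a cube are nearly orthogonal to all vectors of a robustly independent
family: a well-conditioned minor makes such a point a function of its other coordinates. -/
theorem RobustlyIndependent.card_nearly_orthogonal_le {d k₀ N : ℕ} (hd : 0 < d) (hk : k₀ ≤ d)
    (hk0 : 0 < k₀) {ρ σ τ : ℝ} (hρ : 0 < ρ) (hσ : 0 < σ) (hσρ : σ * d ^ 2 < ρ ^ 2)
    (hτ : 0 ≤ τ) (hτσ : 4 * d * τ < σ)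
    {x : Fin (k₀ + k₀) → EuclideanSpace ℝ (Fin d)}
    (hx : RobustlyIndependent ρ x) (hx1 : ∀ j, ‖x j‖ ≤ 1) :
    (Finset.univ.filter fun a : Fin d → Fin N => ∀ j, |∑ i, (a i : ℝ) * x j i| ≤ τ).card * N ^ k₀ ≤
      N ^ d := by
  classical
  obtain ⟨r, hr1, hr2, hpos, hrat⟩ := hx.exists_maxMinor_ratio hd hk hρ hσ hσρ hx1 hk0
  have : Nonempty (Fin (k₀ + k₀)) := ⟨⟨0, by omega⟩⟩
  have : Nonempty (Fin d) := ⟨⟨0, hd⟩⟩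
  obtain ⟨⟨f, g⟩, hfg⟩ := exists_eq_ciSup_of_finite
    (f := fun p : (Fin (r + 1) → Fin (k₀ + k₀)) × (Fin (r + 1) → Fin d) =>
      |(Matrix.of fun a b => x (p.1 a) (p.2 b)).det|)
  change |(Matrix.of fun a b => x (f a) (g b)).det| = maxMinor x (r + 1) at hfg
  set X : Matrix (Fin (r + 1)) (Fin (r + 1)) ℝ := Matrix.of fun a b => x (f a) (g b) with hX
  have hdet0 : X.det ≠ 0 := by rw [← abs_pos, hfg]; exact hpos
  have hginj : Function.Injective g := by
    intro b b' hbb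
    by_contra hne
    exact hdet0 (Matrix.det_zero_of_column_eq hne fun a => by simp [hX, hbb])
  -- the cofactors of `X` are minors of size `r`
  have hadj : ∀ i j, |X.adjugate i j| ≤ maxMinor x r := by
    intro i j
    rw [Matrix.adjugate_fin_succ_eq_det_submatrix, abs_mul, abs_pow, abs_neg, abs_one, one_pow,
      one_mul]
    exact abs_det_le_maxMinor x (f ∘ j.succAbove) (g ∘ i.succAbove)
  have hr_d : r + 1 ≤ d := by simpa using Fintype.card_le_of_injective g hginj
  set Z := Finset.univ.filter fun a : Fin d → Fin N => ∀ j, |∑ i, (a i : ℝ) * x j i| ≤ τ with hZ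
  -- a point of `Z` is determined by its coordinates outside the range of `g`
  have hinj : ∀ a ∈ Z, ∀ a' ∈ Z, (∀ i, i ∉ Set.range g → a i = a' i) → a = a' := by
    intro a ha a' ha' haa
    let z : Fin (r + 1) → ℝ := fun b => (a (g b) : ℝ) - (a' (g b) : ℝ)
    have hXz : ∀ c, |X.mulVec z c| ≤ 2 * τ := by
      intro c
      have h1 : X.mulVec z c = ∑ i, (a i : ℝ) * x (f c) i - ∑ i, (a' i : ℝ) * x (f c) i := by
        rw [← Finset.sum_sub_distrib, Matrix.mulVec, dotProduct,
          ← Finset.sum_subset (Finset.subset_univ (Finset.univ.image g))]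
        · rw [Finset.sum_image fun b _ b' _ h => hginj h]
          refine Finset.sum_congr rfl fun b _ => ?_
          simp only [hX, Matrix.of_apply, z]
          ring
        · intro i _ hi
          rw [haa i (by simpa using hi)]
          ring
      rw [h1]
      have h2 := (Finset.mem_filter.mp ha).2 (f c)
      have h3 := (Finset.mem_filter.mp ha').2 (f c)
      calc _ ≤ |∑ i, (a i : ℝ) * x (f c) i| + |∑ i, (a' i : ℝ) * x (f c) i| := abs_sub _ _
        _ ≤ _ := by linarith
    have hz : ∀ b, |z b| < 1 := by
      intro b
      have h1 : X.det * z b = ∑ c, X.adjugate b c * X.mulVec z c := by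
        have h2 : (X.adjugate.mulVec (X.mulVec z)) b = X.det * z b := by
          rw [Matrix.mulVec_mulVec, Matrix.adjugate_mul, Matrix.smul_mulVec, Matrix.one_mulVec]
          rfl
        rw [← h2]; rfl
      have h2 : |X.det| * |z b| ≤ (r + 1) * (maxMinor x r * (2 * τ)) := by
        rw [← abs_mul, h1]
        refine (Finset.abs_sum_le_sum_abs _ _).trans ?_
        calc _ ≤ ∑ _c : Fin (r + 1), maxMinor x r * (2 * τ) := Finset.sum_le_sum fun c _ => by
              rw [abs_mul]
              exact mul_le_mul (hadj _ _) (hXz _) (abs_nonneg _) (maxMinor_nonneg x)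
          _ = _ := by simp
      rw [hfg] at h2
      by_contra! hge
      have h3 : maxMinor x (r + 1) ≤ (r + 1) * (maxMinor x r * (2 * τ)) := by
        nlinarith
      have hrd : ((r : ℝ) + 1) ≤ d := by exact_mod_cast hr_d
      have hm := maxMinor_nonneg x (r := r)
      have h4 : (r + 1) * (maxMinor x r * (2 * τ)) ≤ 2 * d * τ * maxMinor x r := by
        have : 0 ≤ maxMinor x r * (2 * τ) := by positivity
        nlinarith
      have h5 : 2 * (2 * d * τ * maxMinor x r) ≤ σ * maxMinor x r := by
        nlinarith
      linarith
    funext i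
    by_cases hi : i ∈ Set.range g
    · obtain ⟨b, rfl⟩ := hi
      have := hz b
      have h1 : |((a (g b) : ℕ) : ℤ) - ((a' (g b) : ℕ) : ℤ)| < 1 := by
        have h2 : |(((a (g b) : ℕ) : ℤ) - ((a' (g b) : ℕ) : ℤ) : ℝ)| < 1 := by
          simpa [z] using this
        exact_mod_cast h2
      rw [Int.abs_lt_one_iff] at h1
      exact Fin.ext (by omega)
    · exact haa i hi
  have hcard : Z.card ≤ Fintype.card ({i : Fin d // i ∉ Set.range g} → Fin N) := by
    rw [← Finset.card_univ]
    refine Finset.card_le_card_of_injOn (fun a i => a i.1) (fun _ _ => Finset.mem_coe.mpr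
      (Finset.mem_univ _)) ?_
    intro a ha a' ha' h
    exact hinj a ha a' ha' fun i hi => congrFun h ⟨i, hi⟩
  have hcg : Fintype.card {i : Fin d // i ∉ Set.range g} = d - (r + 1) := by
    have h1 := Fintype.card_subtype_compl (fun i : Fin d => i ∈ Set.range g)
    rw [Fintype.card_fin] at h1
    have h2 : Fintype.card {i : Fin d // i ∈ Set.range g} = r + 1 := by
      have := Set.card_range_of_injective hginj
      rw [Fintype.card_fin] at this
      exact this
    rw [h2] at h1
    exact h1
  rw [Fintype.card_fun, Fintype.card_fin, hcg] at hcard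
  rcases Nat.eq_zero_or_pos N with rfl | hN
  · simp [hk0.ne']
  calc Z.card * N ^ k₀ ≤ N ^ (d - (r + 1)) * N ^ (r + 1) :=
        Nat.mul_le_mul hcard (Nat.pow_le_pow_right hN (by omega))
    _ = N ^ d := by rw [← pow_add]; congr 1; omega

/-! ### Cell sampling -/

/-- If the coordinates of `A` in `Q` are confined to a set of relative size at most `1 / p`, which
depends on the other coordinates only, then at most a fraction `p ^ (-#Q)` of all `A` remains. -/
lemma card_forall_mem_mul_pow_le {n : ℕ} {X : Type*} [Fintype X] [DecidableEq X]
    (Q : Finset (Fin n)) (Z : (Fin n → X) → Finset X)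
    (hZ : ∀ A A', (∀ r ∉ Q, A r = A' r) → Z A = Z A') (p : ℕ)
    (h : ∀ A, (Z A).card * p ≤ Fintype.card X) :
    (Finset.univ.filter fun A : Fin n → X => ∀ r ∈ Q, A r ∈ Z A).card * p ^ Q.card
      ≤ Fintype.card (Fin n → X) := by
  classical
  let e := Equiv.piEquivPiSubtypeProd (fun r => r ∈ Q) (fun _ : Fin n => X)
  have hcard : (Finset.univ.filter fun A : Fin n → X => ∀ r ∈ Q, A r ∈ Z A).card
      ≤ ∑ y : {r // r ∉ Q} → X, (Finset.univ.filter fun x : {r // r ∈ Q} → X =>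
          ∀ r, x r ∈ Z (e.symm (x, y))).card := by
    rw [← Finset.card_sigma]
    refine Finset.card_le_card_of_injOn (fun A => ⟨(e A).2, (e A).1⟩) ?_ ?_
    · intro A hA
      simp only [Finset.coe_filter, Finset.mem_univ, true_and, Set.mem_ofPred_eq] at hA
      simp only [Finset.coe_sigma, Set.mem_sigma_iff, Finset.coe_univ, Set.mem_univ, true_and,
        Finset.coe_filter, Finset.mem_univ, Set.mem_ofPred_eq, Prod.mk.eta, e.symm_apply_apply]
      exact fun r => hA r r.2
    · intro A _ A' _ hAA
      simp only [Sigma.mk.injEq, heq_eq_eq] at hAA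
      exact e.injective (Prod.ext hAA.2 hAA.1)
  have hfib : ∀ y : {r // r ∉ Q} → X, (Finset.univ.filter fun x : {r // r ∈ Q} → X =>
      ∀ r, x r ∈ Z (e.symm (x, y))).card * p ^ Q.card ≤ Fintype.card X ^ Q.card := by
    intro y
    rcases Finset.eq_empty_or_nonempty (Finset.univ.filter fun x : {r // r ∈ Q} → X =>
      ∀ r, x r ∈ Z (e.symm (x, y))) with h0 | ⟨x₀, _⟩
    · rw [h0]; simp
    · have hsub : (Finset.univ.filter fun x : {r // r ∈ Q} → X =>
          ∀ r, x r ∈ Z (e.symm (x, y))) ⊆ Fintype.piFinset fun _ => Z (e.symm (x₀, y)) := by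
        intro x hx
        simp only [Finset.mem_filter, Finset.mem_univ, true_and] at hx
        rw [Fintype.mem_piFinset]
        intro r
        rw [hZ (e.symm (x₀, y)) (e.symm (x, y))]
        · exact hx r
        · intro r hr
          simp [e, Equiv.piEquivPiSubtypeProd, hr]
      calc _ ≤ (Fintype.piFinset fun _ : {r // r ∈ Q} => Z (e.symm (x₀, y))).card * p ^ Q.card :=
            Nat.mul_le_mul_right _ (Finset.card_le_card hsub)
        _ = ((Z (e.symm (x₀, y))).card * p) ^ Q.card := by
            rw [Fintype.card_piFinset]; simp [mul_pow]
        _ ≤ _ := Nat.pow_le_pow_left (h _) _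
  calc _ ≤ (∑ y : {r // r ∉ Q} → X, (Finset.univ.filter fun x : {r // r ∈ Q} → X =>
          ∀ r, x r ∈ Z (e.symm (x, y))).card) * p ^ Q.card := Nat.mul_le_mul_right _ hcard
    _ ≤ ∑ _y : {r // r ∉ Q} → X, Fintype.card X ^ Q.card := by
        rw [Finset.sum_mul]; exact Finset.sum_le_sum fun y _ => hfib y
    _ = Fintype.card (Fin n → X) := by
        rw [Fintype.card_congr e, Fintype.card_prod, Fintype.card_fun]
        simp [mul_comm]

lemma RobustlyIndependent.snoc {d k : ℕ} {ρ : ℝ} {x : Fin k → EuclideanSpace ℝ (Fin d)}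
    (h : RobustlyIndependent ρ x) {y : EuclideanSpace ℝ (Fin d)}
    (hy : ∀ z ∈ Submodule.span ℝ (Set.range x), ρ ≤ ‖y - z‖) :
    RobustlyIndependent ρ (Fin.snoc x y : Fin (k + 1) → EuclideanSpace ℝ (Fin d)) := by
  intro j
  refine Fin.lastCases ?_ (fun j => ?_) j
  · intro z hz
    rw [Fin.snoc_last]
    refine hy z (Submodule.span_mono ?_ hz)
    rintro _ ⟨l, hl, rfl⟩
    obtain ⟨l, rfl⟩ := Fin.exists_castSucc_eq.mpr (ne_of_lt hl)
    exact ⟨l, by simp⟩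
  · intro z hz
    rw [Fin.snoc_castSucc]
    refine h j z (Submodule.span_mono ?_ hz)
    rintro _ ⟨l, hl, rfl⟩
    obtain ⟨l, rfl⟩ := Fin.exists_castSucc_eq.mpr
      (ne_of_lt (lt_of_lt_of_le hl (Fin.le_last _)))
    exact ⟨l, by simpa using hl, by simp⟩

/-- A point that is correlated with `w` but close to `U` forces `w` to have a long projection. -/
lemma le_norm_starProjection_of_norm_sub_lt {d : ℕ} {U : Submodule ℝ (EuclideanSpace ℝ (Fin d))}
    {w x y : EuclideanSpace ℝ (Fin d)} (hw : ‖w‖ ≤ 1) (hx : ‖x‖ ≤ 1) {θ ρ : ℝ}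
    (hwx : θ ≤ |inner ℝ w x|) (hy : y ∈ U) (hxy : ‖x - y‖ < ρ) :
    θ - ρ ≤ ‖U.starProjection w‖ := by
  have h1 : ‖x - U.starProjection x‖ ≤ ‖x - y‖ := by
    rw [Submodule.starProjection_minimal]
    exact ciInf_le ⟨0, by rintro _ ⟨z, rfl⟩; positivity⟩ (⟨y, hy⟩ : U)
  have h2 : inner ℝ w x = inner ℝ (U.starProjection w) (U.starProjection x)
      + inner ℝ w (x - U.starProjection x) := by
    rw [Submodule.inner_starProjection_left_eq_right, Submodule.starProjection_eq_self_iff.mpr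
      (Submodule.starProjection_apply_mem U x), inner_sub_right]
    ring
  have h3 : |inner ℝ (U.starProjection w) (U.starProjection x)| ≤ ‖U.starProjection w‖ := by
    refine (abs_real_inner_le_norm _ _).trans ?_
    have : ‖U.starProjection x‖ ≤ 1 := (U.norm_starProjection_apply_le x).trans hx
    exact mul_le_of_le_one_right (norm_nonneg _) this
  have h4 : |inner ℝ w (x - U.starProjection x)| ≤ ρ := by
    refine (abs_real_inner_le_norm _ _).trans ?_
    nlinarith [norm_nonneg w, norm_nonneg (x - U.starProjection x)]
  have h5 := abs_add_le (inner ℝ (U.starProjection w) (U.starProjection x))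
    (inner ℝ w (x - U.starProjection x))
  rw [← h2] at h5
  linarith

/-- From a large set of sign vectors, each correlated with its own point, many tuples can be drawn
whose points are robustly independent: only few sign vectors have a long projection onto the span
of the points drawn before. -/
lemma pow_le_card_robustlyIndependent {d : ℕ} (hd : 0 < d) (S : Finset (Fin d → Bool))
    (X : (Fin d → Bool) → EuclideanSpace ℝ (Fin d)) (hX : ∀ v, ‖X v‖ ≤ 1) {θ ρ f : ℝ}
    (hθ : 0 ≤ θ) (hρ : ρ ≤ θ / 2) (hS : ∀ v ∈ S, θ ≤ |inner ℝ (signVec v) (X v)|) (K : ℕ)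
    (hf : √2 ^ K * Real.exp (-(d * θ ^ 2 / 16)) ≤ f) (hfS : f * 2 ^ d ≤ S.card) :
    ∀ k ≤ K, ∃ W : Finset (Fin k → Fin d → Bool),
      ((S.card : ℝ) - f * 2 ^ d) ^ k ≤ W.card ∧
      ∀ w ∈ W, (∀ j, w j ∈ S) ∧ RobustlyIndependent ρ (fun j => X (w j)) := by
  classical
  intro k
  induction k with
  | zero =>
    intro _
    exact ⟨Finset.univ, by simp, fun w _ => ⟨fun j => j.elim0, fun j => j.elim0⟩⟩
  | succ k ih =>
    intro hk
    obtain ⟨W, hWc, hW⟩ := ih (by omega)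
    let U : (Fin k → Fin d → Bool) → Submodule ℝ (EuclideanSpace ℝ (Fin d)) :=
      fun w => Submodule.span ℝ (Set.range fun j => X (w j))
    let bad : (Fin k → Fin d → Bool) → Finset (Fin d → Bool) := fun w =>
      Finset.univ.filter fun v => θ / 2 ≤ ‖(U w).starProjection (signVec v)‖
    let P : Finset (Σ _ : Fin k → Fin d → Bool, Fin d → Bool) := W.sigma fun w => S \ bad w
    have hinj : Function.Injective fun p : (Σ _ : Fin k → Fin d → Bool, Fin d → Bool) =>
        (Fin.snoc p.1 p.2 : Fin (k + 1) → Fin d → Bool) := by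
      rintro ⟨w, v⟩ ⟨w', v'⟩ h
      have h' : w = w' ∧ v = v' := Fin.snoc_injective2 h
      rw [h'.1, h'.2]
    refine ⟨P.image fun p => (Fin.snoc p.1 p.2 : Fin (k + 1) → Fin d → Bool), ?_, ?_⟩
    · rw [Finset.card_image_of_injective _ hinj, Finset.card_sigma, Nat.cast_sum, pow_succ]
      calc ((S.card : ℝ) - f * 2 ^ d) ^ k * (S.card - f * 2 ^ d)
          ≤ W.card * (S.card - f * 2 ^ d) :=
            mul_le_mul_of_nonneg_right hWc (sub_nonneg.mpr hfS)
        _ = ∑ _w ∈ W, ((S.card : ℝ) - f * 2 ^ d) := by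
            rw [Finset.sum_const, nsmul_eq_mul]
        _ ≤ ∑ w ∈ W, ((S \ bad w).card : ℝ) := Finset.sum_le_sum fun w _ => ?_
      have h1 : S.card ≤ (S \ bad w).card + (bad w).card := by
        rw [add_comm]; exact Finset.card_le_card_sdiff_add_card.trans (add_comm _ _).le
      have h2 : ((bad w).card : ℝ) ≤ f * 2 ^ d := by
        have hr : Module.finrank ℝ (U w) ≤ K := by
          refine (finrank_range_le_card (R := ℝ) fun j => X (w j)).trans ?_
          simp; omega
        refine (card_le_norm_proj_signVec_le hd (U w) hr (t := θ / 2) (by positivity)).trans ?_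
        refine mul_le_mul_of_nonneg_right ?_ (by positivity)
        have h3 : -(d * (θ / 2) ^ 2 / 4) = -(d * θ ^ 2 / 16) := by ring
        rw [h3]
        exact hf
      have h3 : (S.card : ℝ) ≤ (S \ bad w).card + (bad w).card := by exact_mod_cast h1
      linarith
    · intro w' hw'
      obtain ⟨⟨w, v⟩, hp, rfl⟩ := Finset.mem_image.mp hw'
      obtain ⟨hwW, hv⟩ := Finset.mem_sigma.mp hp
      simp only [Finset.mem_sdiff] at hv hwW
      obtain ⟨hvS, hvb⟩ := hv
      refine ⟨fun j => ?_, ?_⟩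
      · refine Fin.lastCases ?_ (fun j => ?_) j
        · simpa using hvS
        · simpa using (hW w hwW).1 j
      · have : (fun j => X ((Fin.snoc w v : Fin (k + 1) → Fin d → Bool) j))
            = (Fin.snoc (fun j => X (w j)) (X v) :
                Fin (k + 1) → EuclideanSpace ℝ (Fin d)) := by
          funext j
          refine Fin.lastCases ?_ (fun j => ?_) j <;> simp
        show RobustlyIndependent ρ
          (fun j => X ((Fin.snoc w v : Fin (k + 1) → Fin d → Bool) j))
        rw [this]
        refine (hW w hwW).2.snoc fun z hz => ?_
        by_contra! hlt
        refine hvb (Finset.mem_filter.mpr ⟨Finset.mem_univ _, ?_⟩)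
        have := le_norm_starProjection_of_norm_sub_lt (U := U w) (norm_signVec_le v) (hX v)
          (hS v hvS) hz hlt
        linarith

lemma card_tuple_bool (k d : ℕ) :
    (Fintype.card (Fin k → Fin d → Bool) : ℝ) = (2 ^ d) ^ k := by
  rw [Fintype.card_fun, Fintype.card_fun, Fintype.card_bool, Fintype.card_fin, Fintype.card_fin]
  push_cast
  rfl

/-- Suppose that, for each matrix `A` of a set `W`, a constant proportion of the sign vectors `v`
are correlated with a point `ξ α (M A α) A v` which is nearly orthogonal to all rows of `A`, where
the label `α` is one of few, the message `M A α` is one of few, and otherwise the point does not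
depend on the `b` rows in `Q α`. Then `W` is small: most labels and messages would leave `b` rows
orthogonal to `2 * k₀` robustly independent vectors that do not depend on these rows. -/
theorem card_mul_pow_le_of_cell_sampling {d n N k₀ b : ℕ} (hd : 0 < d) (hk : k₀ ≤ d) (hk0 : 0 < k₀)
    {Λ 𝓜 : Type*} [Fintype Λ] [Fintype 𝓜] {ρ σ τ θ q : ℝ} (hρ : 0 < ρ) (hσ : 0 < σ)
    (hσρ : σ * d ^ 2 < ρ ^ 2) (hτ : 0 ≤ τ) (hτσ : 4 * d * τ < σ) (hρθ : ρ ≤ θ / 2)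
    (hq : Fintype.card Λ * q ≤ 1 / 8)
    (hf : √2 ^ (k₀ + k₀) * Real.exp (-(d * θ ^ 2 / 16)) ≤ q / 2)
    (Q : Λ → Finset (Fin n)) (hQ : ∀ α, (Q α).card = b)
    (ξ : Λ → 𝓜 → (Fin n → Fin d → Fin N) → (Fin d → Bool) → EuclideanSpace ℝ (Fin d))
    (hξ : ∀ α μ A A', (∀ r ∉ Q α, A r = A' r) → ∀ v, ξ α μ A v = ξ α μ A' v)
    (hξ1 : ∀ α μ A v, ‖ξ α μ A v‖ ≤ 1) (M : (Fin n → Fin d → Fin N) → Λ → 𝓜)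
    (W : Finset (Fin n → Fin d → Fin N)) (H : (Fin n → Fin d → Fin N) → Finset (Fin d → Bool))
    (hW : ∀ A ∈ W, (1 / 8 : ℝ) * 2 ^ d ≤ (H A).card)
    (hH : ∀ A, ∀ v ∈ H A, ∃ α, θ ≤ |inner ℝ (signVec v) (ξ α (M A α) A v)| ∧
      ∀ r, |∑ i, (A r i : ℝ) * ξ α (M A α) A v i| ≤ τ) :
    (W.card : ℝ) * (q / 2) ^ (k₀ + k₀) * (N : ℝ) ^ (k₀ * b)
      ≤ Fintype.card Λ * Fintype.card 𝓜 * Fintype.card (Fin n → Fin d → Fin N) := by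
  classical
  let good : Λ → 𝓜 → (Fin (k₀ + k₀) → Fin d → Bool) → (Fin n → Fin d → Fin N) → Prop :=
    fun α μ w A => RobustlyIndependent ρ (fun j => ξ α μ A (w j)) ∧
      ∀ r ∈ Q α, ∀ j, |∑ i, (A r i : ℝ) * ξ α μ A (w j) i| ≤ τ
  have hθ : 0 ≤ θ := by linarith
  have hq0 : 0 ≤ q := by
    have : (0 : ℝ) ≤ q / 2 := le_trans (by positivity) hf
    linarith
  -- for a fixed label, message and tuple, few matrices are possible
  have hfix : ∀ α μ w, ((Finset.univ.filter (good α μ w)).card : ℝ) * (N : ℝ) ^ (k₀ * b)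
      ≤ Fintype.card (Fin n → Fin d → Fin N) := by
    intro α μ w
    let Z : (Fin n → Fin d → Fin N) → Finset (Fin d → Fin N) := fun A =>
      if RobustlyIndependent ρ (fun j => ξ α μ A (w j)) then
        Finset.univ.filter fun a => ∀ j, |∑ i, (a i : ℝ) * ξ α μ A (w j) i| ≤ τ else ∅
    have h := card_forall_mem_mul_pow_le (Q α) Z (fun A A' hA => by
      have : ∀ v, ξ α μ A v = ξ α μ A' v := hξ α μ A A' hA
      simp only [Z, this]) (N ^ k₀) (fun A => by
      simp only [Z]
      split_ifs with hr
      · refine (RobustlyIndependent.card_nearly_orthogonal_le hd hk hk0 hρ hσ hσρ hτ hτσ hr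
          (fun j => hξ1 _ _ _ _)).trans ?_
        simp
      · simp)
    rw [hQ, ← pow_mul] at h
    refine le_trans ?_ (Nat.cast_le.mpr h)
    push_cast
    refine mul_le_mul_of_nonneg_right ?_ (by positivity)
    refine Nat.cast_le.mpr (Finset.card_le_card ?_)
    intro A hA
    simp only [Finset.mem_filter, Finset.mem_univ, true_and] at hA ⊢
    intro r hr
    simp only [Z, if_pos hA.1, Finset.mem_filter, Finset.mem_univ, true_and]
    exact hA.2 r hr
  -- each matrix of `W` is possible for many tuples
  have hmany : ∀ A ∈ W, (q / 2) ^ (k₀ + k₀) * (2 ^ d) ^ (k₀ + k₀)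
      ≤ ∑ α, ∑ μ, ((Finset.univ.filter fun w => good α μ w A).card : ℝ) := by
    intro A hA
    let Sα : Λ → Finset (Fin d → Bool) := fun α => (H A).filter fun v =>
      θ ≤ |inner ℝ (signVec v) (ξ α (M A α) A v)| ∧
        ∀ r, |∑ i, (A r i : ℝ) * ξ α (M A α) A v i| ≤ τ
    obtain ⟨α, hα⟩ : ∃ α, q * 2 ^ d ≤ (Sα α).card := by
      by_contra! hlt
      have h1 : H A ⊆ Finset.univ.biUnion Sα := by
        intro v hv
        obtain ⟨α, hα⟩ := hH A v hv
        exact Finset.mem_biUnion.mpr ⟨α, Finset.mem_univ _, Finset.mem_filter.mpr ⟨hv, hα⟩⟩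
      have h2 : ((H A).card : ℝ) ≤ ∑ α, ((Sα α).card : ℝ) := by
        exact_mod_cast (Finset.card_le_card h1).trans Finset.card_biUnion_le
      have h3 : (Finset.univ : Finset Λ).Nonempty := by
        by_contra hne
        rw [Finset.not_nonempty_iff_eq_empty] at hne
        rw [hne, Finset.sum_empty] at h2
        have := hW A hA
        have : (0 : ℝ) < 2 ^ d := by positivity
        linarith
      have h4 : ∑ α, ((Sα α).card : ℝ) < ∑ _α : Λ, q * 2 ^ d :=
        Finset.sum_lt_sum_of_nonempty h3 fun α _ => hlt α
      rw [Finset.sum_const, Finset.card_univ, nsmul_eq_mul, ← mul_assoc] at h4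
      have := hW A hA
      have h5 : (Fintype.card Λ * q) * (2 : ℝ) ^ d ≤ 1 / 8 * 2 ^ d :=
        mul_le_mul_of_nonneg_right hq (by positivity)
      linarith
    obtain ⟨T, hTc, hT⟩ := pow_le_card_robustlyIndependent hd (Sα α)
      (fun v => ξ α (M A α) A v) (fun v => hξ1 _ _ _ _) hθ hρθ
      (fun v hv => (Finset.mem_filter.mp hv).2.1) (k₀ + k₀) hf
      (le_trans (mul_le_mul_of_nonneg_right (by linarith) (by positivity)) hα) (k₀ + k₀) le_rfl
    have hsub : T ⊆ Finset.univ.filter fun w => good α (M A α) w A := by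
      intro w hw
      refine Finset.mem_filter.mpr ⟨Finset.mem_univ _, (hT w hw).2, fun r _ j => ?_⟩
      exact (Finset.mem_filter.mp ((hT w hw).1 j)).2.2 r
    calc (q / 2) ^ (k₀ + k₀) * (2 ^ d) ^ (k₀ + k₀) = (q / 2 * 2 ^ d) ^ (k₀ + k₀) :=
          (mul_pow _ _ _).symm
      _ ≤ (((Sα α).card : ℝ) - q / 2 * 2 ^ d) ^ (k₀ + k₀) := by
          refine pow_le_pow_left₀ (by positivity) ?_ _
          linarith
      _ ≤ T.card := hTc
      _ ≤ (Finset.univ.filter fun w => good α (M A α) w A).card := by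
          exact_mod_cast Finset.card_le_card hsub
      _ ≤ ∑ μ, ((Finset.univ.filter fun w => good α μ w A).card : ℝ) :=
          Finset.single_le_sum (f := fun μ => ((Finset.univ.filter fun w => good α μ w A).card : ℝ))
            (fun _ _ => Nat.cast_nonneg _) (Finset.mem_univ (M A α))
      _ ≤ _ := Finset.single_le_sum
            (f := fun α => ∑ μ, ((Finset.univ.filter fun w => good α μ w A).card : ℝ))
            (fun _ _ => Finset.sum_nonneg fun _ _ => Nat.cast_nonneg _) (Finset.mem_univ α)
  have hswap : ∑ A : Fin n → Fin d → Fin N, ∑ α, ∑ μ,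
        ((Finset.univ.filter fun w => good α μ w A).card : ℝ)
      = ∑ α, ∑ μ, ∑ w, ((Finset.univ.filter (good α μ w)).card : ℝ) := by
    simp only [Finset.card_filter, Nat.cast_sum]
    rw [Finset.sum_comm]
    refine Finset.sum_congr rfl fun α _ => ?_
    rw [Finset.sum_comm]
    refine Finset.sum_congr rfl fun μ _ => ?_
    rw [Finset.sum_comm]
  have hpos : (0 : ℝ) < (2 ^ d) ^ (k₀ + k₀) := by positivity
  refine le_of_mul_le_mul_right ?_ hpos
  calc (W.card : ℝ) * (q / 2) ^ (k₀ + k₀) * (N : ℝ) ^ (k₀ * b) * (2 ^ d) ^ (k₀ + k₀)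
      = (∑ _A ∈ W, (q / 2) ^ (k₀ + k₀) * (2 ^ d) ^ (k₀ + k₀)) * (N : ℝ) ^ (k₀ * b) := by
        rw [Finset.sum_const, nsmul_eq_mul]; ring
    _ ≤ (∑ A : Fin n → Fin d → Fin N, ∑ α, ∑ μ,
          ((Finset.univ.filter fun w => good α μ w A).card : ℝ)) * (N : ℝ) ^ (k₀ * b) := by
        refine mul_le_mul_of_nonneg_right ?_ (by positivity)
        refine (Finset.sum_le_sum hmany).trans ?_
        exact Finset.sum_le_sum_of_subset_of_nonneg (Finset.subset_univ _)
          fun _ _ _ => Finset.sum_nonneg fun _ _ => Finset.sum_nonneg fun _ _ =>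
            Nat.cast_nonneg _
    _ = ∑ α, ∑ μ, ∑ w, ((Finset.univ.filter (good α μ w)).card : ℝ) * (N : ℝ) ^ (k₀ * b) := by
        rw [hswap]; simp only [Finset.sum_mul]
    _ ≤ ∑ _α : Λ, ∑ _μ : 𝓜, ∑ _w : Fin (k₀ + k₀) → Fin d → Bool,
          (Fintype.card (Fin n → Fin d → Fin N) : ℝ) :=
        Finset.sum_le_sum fun α _ => Finset.sum_le_sum fun μ _ => Finset.sum_le_sum fun w _ =>
          hfix α μ w
    _ = _ := by
        rw [Finset.sum_const, Finset.sum_const, Finset.sum_const, nsmul_eq_mul, nsmul_eq_mul,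
          nsmul_eq_mul, Finset.card_univ, Finset.card_univ, Finset.card_univ,
          card_tuple_bool]
        ring

/-! ### Maxima of affine functions -/

section FirstMax

variable {ι : Type*} [Encodable ι] [Inhabited ι]

/-- The index in `P` at which `f` is maximal; among several, the first in the enumeration of `ι`.
The tie-breaking makes the choice consistent under restriction of `P`. -/
noncomputable def firstMax (P : Finset ι) (f : ι → ℝ) : ι :=
  if h : P.Nonempty then
    (P.exists_max_image (fun p => toLex (f p, OrderDual.toDual (Encodable.encode p))) h).choose
  else default

lemma firstMax_mem {P : Finset ι} (h : P.Nonempty) (f : ι → ℝ) : firstMax P f ∈ P := by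
  rw [firstMax, dif_pos h]
  exact (P.exists_max_image (fun p => toLex (f p, OrderDual.toDual (Encodable.encode p)))
    h).choose_spec.1

lemma toLex_le_toLex_firstMax {P : Finset ι} (f : ι → ℝ) {q : ι} (hq : q ∈ P) :
    toLex (f q, OrderDual.toDual (Encodable.encode q)) ≤
      toLex (f (firstMax P f), OrderDual.toDual (Encodable.encode (firstMax P f))) := by
  have h : P.Nonempty := ⟨q, hq⟩
  rw [firstMax, dif_pos h]
  exact (P.exists_max_image (fun p => toLex (f p, OrderDual.toDual (Encodable.encode p)))
    h).choose_spec.2 q hq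

lemma le_firstMax {P : Finset ι} (f : ι → ℝ) {q : ι} (hq : q ∈ P) : f q ≤ f (firstMax P f) := by
  have := toLex_le_toLex_firstMax f hq
  rw [Prod.Lex.toLex_le_toLex] at this
  rcases this with h | h
  · exact h.le
  · exact h.1.le

lemma eq_firstMax {P : Finset ι} {f : ι → ℝ} {p : ι} (hp : p ∈ P)
    (h : ∀ q ∈ P, toLex (f q, OrderDual.toDual (Encodable.encode q)) ≤
      toLex (f p, OrderDual.toDual (Encodable.encode p))) : firstMax P f = p := by
  have h1 := h _ (firstMax_mem ⟨p, hp⟩ f)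
  have h2 := le_antisymm h1 (toLex_le_toLex_firstMax f hp)
  have h3 := congrArg Prod.snd (toLex.injective h2)
  exact Encodable.encode_injective (OrderDual.toDual.injective h3)

lemma firstMax_eq_of_subset {P Q : Finset ι} (hQP : Q ⊆ P) {f : ι → ℝ}
    (h : firstMax P f ∈ Q) : firstMax Q f = firstMax P f :=
  eq_firstMax h fun _ hq => toLex_le_toLex_firstMax f (hQP hq)

lemma firstMax_congr {P : Finset ι} (hP : P.Nonempty) {f g : ι → ℝ} (h : ∀ p ∈ P, f p = g p) :
    firstMax P f = firstMax P g :=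
  eq_firstMax (firstMax_mem hP g) fun q hq => by
    rw [h q hq, h _ (firstMax_mem hP g)]
    exact toLex_le_toLex_firstMax g hq

variable {d : ℕ}

/-- The index of the first maximal one among the affine functions `⟪G p, x⟫ + c p`, `p ∈ P`. -/
noncomputable def activePiece (c : ι → ℝ) (P : Finset ι) (G : ι → EuclideanSpace ℝ (Fin d))
    (x : EuclideanSpace ℝ (Fin d)) : ι :=
  firstMax P fun p => inner ℝ (G p) x + c p

/-- First-order oracle of the maximum of the affine functions `⟪G p, x⟫ + c p`, `p ∈ P`: value
and gradient of the first maximal piece. -/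
noncomputable def maxAnswer (c : ι → ℝ) (P : Finset ι) (G : ι → EuclideanSpace ℝ (Fin d))
    (x : EuclideanSpace ℝ (Fin d)) : ℝ × EuclideanSpace ℝ (Fin d) :=
  (inner ℝ (G (activePiece c P G x)) x + c (activePiece c P G x), G (activePiece c P G x))

lemma le_maxAnswer (c : ι → ℝ) {P : Finset ι} (G : ι → EuclideanSpace ℝ (Fin d))
    (x : EuclideanSpace ℝ (Fin d)) {p : ι} (hp : p ∈ P) :
    inner ℝ (G p) x + c p ≤ (maxAnswer c P G x).1 :=
  le_firstMax (fun p => inner ℝ (G p) x + c p) hp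

lemma maxAnswer_eq_of_subset {c : ι → ℝ} {P Q : Finset ι} (hQP : Q ⊆ P)
    {G : ι → EuclideanSpace ℝ (Fin d)} {x : EuclideanSpace ℝ (Fin d)}
    (h : activePiece c P G x ∈ Q) : maxAnswer c Q G x = maxAnswer c P G x := by
  have : activePiece c Q G x = activePiece c P G x := firstMax_eq_of_subset hQP h
  rw [maxAnswer, maxAnswer, this]

lemma maxAnswer_congr {c : ι → ℝ} {P : Finset ι} (hP : P.Nonempty)
    {G G' : ι → EuclideanSpace ℝ (Fin d)} (h : ∀ p ∈ P, G p = G' p) :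
    maxAnswer c P G = maxAnswer c P G' := by
  funext x
  have h1 : activePiece c P G x = activePiece c P G' x :=
    firstMax_congr hP fun p hp => by rw [h p hp]
  have h2 : G (activePiece c P G' x) = G' (activePiece c P G' x) := h _ (firstMax_mem hP _)
  rw [maxAnswer, maxAnswer, h1, h2]

lemma isConvexLipschitz_maxAnswer [Fintype ι] (c : ι → ℝ) {G : ι → EuclideanSpace ℝ (Fin d)}
    (hG : ∀ p, ‖G p‖ ≤ 1) : IsConvexLipschitz fun x => (maxAnswer c Finset.univ G x).1 := by
  constructor
  · refine ⟨convex_closedBall _ _, fun x _ y _ a b ha hb hab => ?_⟩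
    set p := activePiece c Finset.univ G (a • x + b • y) with hp
    have h1 := le_maxAnswer c G x (Finset.mem_univ p)
    have h2 := le_maxAnswer c G y (Finset.mem_univ p)
    have h3 : (maxAnswer c Finset.univ G (a • x + b • y)).1
        = a * (inner ℝ (G p) x + c p) + b * (inner ℝ (G p) y + c p) := by
      rw [maxAnswer, ← hp]
      simp only [inner_add_right, inner_smul_right]
      linear_combination (-c p) * hab
    simp only [h3, smul_eq_mul]
    exact add_le_add (mul_le_mul_of_nonneg_left h1 ha) (mul_le_mul_of_nonneg_left h2 hb)
  · have key : ∀ x y, (maxAnswer c Finset.univ G x).1 - (maxAnswer c Finset.univ G y).1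
        ≤ dist x y := by
      intro x y
      have h1 := le_maxAnswer c G y (Finset.mem_univ (activePiece c Finset.univ G x))
      have h2 : inner ℝ (G (activePiece c Finset.univ G x)) (x - y) ≤ ‖x - y‖ :=
        (real_inner_le_norm _ _).trans (mul_le_of_le_one_left (norm_nonneg _) (hG _))
      rw [inner_sub_right] at h2
      rw [dist_eq_norm]
      simp only [maxAnswer] at h1 ⊢
      linarith
    refine LipschitzOnWith.of_dist_le_mul fun x _ y _ => ?_
    rw [NNReal.coe_one, one_mul, Real.dist_eq, abs_sub_le_iff]
    exact ⟨key x y, dist_comm x y ▸ key y x⟩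

lemma isSubgradientOracle_maxAnswer [Fintype ι] (c : ι → ℝ) {G : ι → EuclideanSpace ℝ (Fin d)}
    (hG : ∀ p, ‖G p‖ ≤ 1) : IsSubgradientOracle (fun x => (maxAnswer c Finset.univ G x).1)
      (fun x => (maxAnswer c Finset.univ G x).2) := by
  refine fun x _ => ⟨fun y _ => ?_, hG _⟩
  have h1 := le_maxAnswer c G y (Finset.mem_univ (activePiece c Finset.univ G x))
  simp only [maxAnswer] at h1 ⊢
  rw [inner_sub_right]
  linarith

end FirstMax

/-! ### Runs of a deterministic algorithm -/

namespace DetAlgorithm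

variable {d S T : ℕ}

/-- The query at time `t`, as a function of the memory; from time `T` on, this is the output. -/
noncomputable def queryAt (A : DetAlgorithm d S T) (t : ℕ) (M : Memory S) :
    EuclideanSpace ℝ (Fin d) :=
  if h : t < T then A.query ⟨t, h⟩ M else A.output M

/-- The memory after `u` iterations that start at time `t₀` with memory `M₀` and are answered
by `o`, which returns value and subgradient together. -/
noncomputable def memoryFrom (A : DetAlgorithm d S T)
    (o : EuclideanSpace ℝ (Fin d) → ℝ × EuclideanSpace ℝ (Fin d)) (t₀ : ℕ) (M₀ : Memory S) :
    ℕ → Memory S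
  | 0 => M₀
  | u + 1 =>
    if h : t₀ + u < T then
      A.update ⟨t₀ + u, h⟩ (A.memoryFrom o t₀ M₀ u)
        (o (A.queryAt (t₀ + u) (A.memoryFrom o t₀ M₀ u))).1
        (o (A.queryAt (t₀ + u) (A.memoryFrom o t₀ M₀ u))).2
    else A.memoryFrom o t₀ M₀ u

/-- The query made `u` iterations after time `t₀`, in the run of `DetAlgorithm.memoryFrom`. -/
noncomputable def queryFrom (A : DetAlgorithm d S T)
    (o : EuclideanSpace ℝ (Fin d) → ℝ × EuclideanSpace ℝ (Fin d)) (t₀ : ℕ) (M₀ : Memory S)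
    (u : ℕ) : EuclideanSpace ℝ (Fin d) :=
  A.queryAt (t₀ + u) (A.memoryFrom o t₀ M₀ u)

lemma norm_queryFrom_le (A : DetAlgorithm d S T)
    (o : EuclideanSpace ℝ (Fin d) → ℝ × EuclideanSpace ℝ (Fin d)) (t₀ : ℕ) (M₀ : Memory S)
    (u : ℕ) : ‖A.queryFrom o t₀ M₀ u‖ ≤ 1 := by
  rw [queryFrom, queryAt]
  split_ifs
  · exact mem_closedBall_zero_iff.mp (A.query _ _).2
  · exact mem_closedBall_zero_iff.mp (A.output _).2

lemma memoryFrom_zero_init (A : DetAlgorithm d S T)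
    (o : EuclideanSpace ℝ (Fin d) → ℝ × EuclideanSpace ℝ (Fin d)) (t : ℕ) :
    A.memoryFrom o 0 A.init t = A.memory (fun x => (o x).1) (fun x => (o x).2) t := by
  induction t with
  | zero => rfl
  | succ t ih =>
    rw [memoryFrom, memory, ih]
    by_cases h : t < T
    · simp [h, queryAt]
    · simp [h]

lemma run_eq_queryFrom (A : DetAlgorithm d S T)
    (o : EuclideanSpace ℝ (Fin d) → ℝ × EuclideanSpace ℝ (Fin d)) :
    A.run (fun x => (o x).1) (fun x => (o x).2) = A.queryFrom o 0 A.init T := by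
  rw [run, queryFrom, queryAt, memoryFrom_zero_init]
  simp

lemma memoryFrom_add (A : DetAlgorithm d S T)
    (o : EuclideanSpace ℝ (Fin d) → ℝ × EuclideanSpace ℝ (Fin d)) (t₀ : ℕ) (M₀ : Memory S)
    (a u : ℕ) : A.memoryFrom o t₀ M₀ (a + u)
      = A.memoryFrom o (t₀ + a) (A.memoryFrom o t₀ M₀ a) u := by
  induction u with
  | zero => rfl
  | succ u ih =>
    rw [← add_assoc, memoryFrom, memoryFrom, ih]
    simp only [add_assoc]

lemma queryFrom_add (A : DetAlgorithm d S T)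
    (o : EuclideanSpace ℝ (Fin d) → ℝ × EuclideanSpace ℝ (Fin d)) (t₀ : ℕ) (M₀ : Memory S)
    (a u : ℕ) : A.queryFrom o t₀ M₀ (a + u)
      = A.queryFrom o (t₀ + a) (A.memoryFrom o t₀ M₀ a) u := by
  rw [queryFrom, queryFrom, memoryFrom_add, add_assoc]

/-- Two runs agree as long as all answers of the first agree with those of the other oracle. -/
lemma memoryFrom_congr (A : DetAlgorithm d S T)
    {o o' : EuclideanSpace ℝ (Fin d) → ℝ × EuclideanSpace ℝ (Fin d)} {t₀ : ℕ} {M₀ : Memory S}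
    {U : ℕ} (h : ∀ u < U, o' (A.queryFrom o t₀ M₀ u) = o (A.queryFrom o t₀ M₀ u)) :
    ∀ u ≤ U, A.memoryFrom o' t₀ M₀ u = A.memoryFrom o t₀ M₀ u := by
  intro u
  induction u with
  | zero => intro _; rfl
  | succ u ih =>
    intro hu
    have h1 := h u (by omega)
    rw [queryFrom] at h1
    rw [memoryFrom, memoryFrom, ih (by omega), h1]

lemma queryFrom_congr (A : DetAlgorithm d S T)
    {o o' : EuclideanSpace ℝ (Fin d) → ℝ × EuclideanSpace ℝ (Fin d)} {t₀ : ℕ} {M₀ : Memory S}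
    {U : ℕ} (h : ∀ u < U, o' (A.queryFrom o t₀ M₀ u) = o (A.queryFrom o t₀ M₀ u)) {u : ℕ}
    (hu : u ≤ U) : A.queryFrom o' t₀ M₀ u = A.queryFrom o t₀ M₀ u := by
  rw [queryFrom, queryFrom, A.memoryFrom_congr h u hu]

end DetAlgorithm

/-- Averaging over the random choice: on a finite family of instances, some deterministic algorithm
succeeds for a proportion `p`. -/
lemma RandAlgorithm.FindsEpsOptimal.exists_detAlgorithm {d S T : ℕ} {R : RandAlgorithm d S T}
    {ε p : ℝ} (h : R.FindsEpsOptimal ε p) {Ω : Type*} [Fintype Ω]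
    {F : Ω → EuclideanSpace ℝ (Fin d) → ℝ}
    {g : Ω → EuclideanSpace ℝ (Fin d) → EuclideanSpace ℝ (Fin d)}
    (hF : ∀ ω, IsConvexLipschitz (F ω)) (hg : ∀ ω, IsSubgradientOracle (F ω) (g ω)) :
    ∃ (A : DetAlgorithm d S T) (W : Finset Ω), p * Fintype.card Ω ≤ W.card ∧
      ∀ ω ∈ W, IsEpsOptimal (F ω) ε (A.run (F ω) (g ω)) := by
  classical
  let _ := R.mspace
  have := R.isProb
  choose E hEm hE hEp using fun ω => h (F ω) (g ω) (hF ω) (hg ω)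
  have hint : ∫⁻ A, (∑ ω, (E ω).indicator (fun _ => (1 : ENNReal)) A) ∂(R.law)
      = ∑ ω, R.law (E ω) := by
    rw [lintegral_finsetSum _ fun ω _ => measurable_const.indicator (hEm ω)]
    exact Finset.sum_congr rfl fun ω _ => lintegral_indicator_one (hEm ω)
  have hfin : ∫⁻ A, (∑ ω, (E ω).indicator (fun _ => (1 : ENNReal)) A) ∂(R.law) ≠ ⊤ := by
    rw [hint]
    exact ENNReal.sum_ne_top.mpr fun ω _ => measure_ne_top _ _
  obtain ⟨A, hA⟩ := exists_lintegral_le hfin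
  refine ⟨A, Finset.univ.filter fun ω => A ∈ E ω, ?_, fun ω hω =>
    hE ω A (Finset.mem_filter.mp hω).2⟩
  have h1 : ∑ ω, (E ω).indicator (fun _ => (1 : ENNReal)) A
      = ((Finset.univ.filter fun ω => A ∈ E ω).card : ENNReal) := by
    simp [Set.indicator_apply]
  rw [hint, h1] at hA
  have h2 : (Fintype.card Ω : ENNReal) * ENNReal.ofReal p
      ≤ ((Finset.univ.filter fun ω => A ∈ E ω).card : ENNReal) := by
    refine le_trans ?_ hA
    calc (Fintype.card Ω : ENNReal) * ENNReal.ofReal p = ∑ _ω : Ω, ENNReal.ofReal p := by simp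
      _ ≤ _ := Finset.sum_le_sum fun ω _ => hEp ω
  have h3 := ENNReal.toReal_mono (ENNReal.natCast_ne_top _) h2
  rw [ENNReal.toReal_mul, ENNReal.toReal_natCast, ENNReal.toReal_natCast] at h3
  refine le_trans ?_ h3
  rw [mul_comm]
  refine mul_le_mul_of_nonneg_left ?_ (Nat.cast_nonneg _)
  rw [ENNReal.toReal_ofReal']
  exact le_max_left _ _

/-! ### The hard instances -/

section Instances

variable {d n N B : ℕ}

/-- A vector of bounded naturals as a point of Euclidean space. -/
noncomputable def rowVec (a : Fin d → Fin N) : EuclideanSpace ℝ (Fin d) :=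
  WithLp.toLp 2 fun i => ((a i : ℕ) : ℝ)

lemma inner_rowVec (a : Fin d → Fin N) (x : EuclideanSpace ℝ (Fin d)) :
    inner ℝ (rowVec a) x = ∑ i, (a i : ℝ) * x i := by
  simp [rowVec, PiLp.inner_apply, mul_comm]

lemma norm_rowVec_le (a : Fin d → Fin N) : ‖rowVec a‖ ≤ N * d := by
  have h : ‖rowVec a‖ ^ 2 ≤ (N * d) ^ 2 := by
    rw [EuclideanSpace.norm_sq_eq]
    calc ∑ i, ‖rowVec a i‖ ^ 2 ≤ ∑ _i : Fin d, (N : ℝ) ^ 2 := by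
          refine Finset.sum_le_sum fun i _ => ?_
          have : ((a i : ℕ) : ℝ) ≤ N := by exact_mod_cast (a i).2.le
          simp only [rowVec, Real.norm_eq_abs, sq_abs]
          exact pow_le_pow_left₀ (Nat.cast_nonneg _) this 2
      _ = d * (N : ℝ) ^ 2 := by simp
      _ ≤ (N * d) ^ 2 := by
          rw [mul_pow, mul_comm]
          refine mul_le_mul_of_nonneg_left ?_ (by positivity)
          exact_mod_cast Nat.le_self_pow two_ne_zero d
  exact le_of_sq_le_sq h (by positivity)

/-- The pieces of the hard function: two for each row of the matrix, one for each key. -/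
abbrev PieceIndex (n B : ℕ) : Type := (Fin n × Bool) ⊕ Fin (B + 1)

/-- Gradients of the pieces: `±` the normalized rows of `A`, and the sign vectors scaled by `s`. -/
noncomputable def pieceGrad (s : ℝ) (A : Fin n → Fin d → Fin N) (V : Fin (B + 1) → Fin d → Bool) :
    PieceIndex n B → EuclideanSpace ℝ (Fin d)
  | .inl p => ((if p.2 then 1 else -1) / (N * d : ℝ)) • rowVec (A p.1)
  | .inr j => s • signVec (V j)

/-- Constant terms of the pieces. The key with index `j` is delayed by `j * γ`, so that a point that
is nearly orthogonal to the keys from `j` on meets the key `j` before the later ones. -/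
noncomputable def pieceOffset (s γ : ℝ) : PieceIndex n B → ℝ
  | .inl _ => -(3 * s)
  | .inr j => -(s * (j * γ))

/-- The rows outside of `Q` and the keys of index less than `i`. -/
def visiblePieces (B : ℕ) (Q : Finset (Fin n)) (i : ℕ) : Finset (PieceIndex n B) :=
  (Finset.univ.filter fun p : Fin n × Bool => p.1 ∉ Q).disjSum
    (Finset.univ.filter fun j : Fin (B + 1) => (j : ℕ) < i)

@[simp] lemma inl_mem_visiblePieces {Q : Finset (Fin n)} {i : ℕ} {p : Fin n × Bool} :
    (Sum.inl p : PieceIndex n B) ∈ visiblePieces B Q i ↔ p.1 ∉ Q := by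
  simp [visiblePieces]

@[simp] lemma inr_mem_visiblePieces {Q : Finset (Fin n)} {i : ℕ} {j : Fin (B + 1)} :
    (Sum.inr j : PieceIndex n B) ∈ visiblePieces B Q i ↔ (j : ℕ) < i := by
  simp [visiblePieces]

/-- Value and subgradient answered on the instance `(A, V)`, reduced to the pieces in `P`. -/
noncomputable def hardOracle (s γ : ℝ) (A : Fin n → Fin d → Fin N)
    (V : Fin (B + 1) → Fin d → Bool) (P : Finset (PieceIndex n B)) :
    EuclideanSpace ℝ (Fin d) → ℝ × EuclideanSpace ℝ (Fin d) :=
  maxAnswer (pieceOffset s γ) P (pieceGrad s A V)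

lemma norm_pieceGrad_le {s : ℝ} (hs : 0 ≤ s) (hs1 : s ≤ 1) (A : Fin n → Fin d → Fin N)
    (V : Fin (B + 1) → Fin d → Bool) (p : PieceIndex n B) : ‖pieceGrad s A V p‖ ≤ 1 := by
  rcases p with p | j
  · have h1 : |(if p.2 then (1 : ℝ) else -1)| = 1 := by split_ifs <;> simp
    rw [pieceGrad, norm_smul, Real.norm_eq_abs, abs_div, h1,
      abs_of_nonneg (by positivity : (0 : ℝ) ≤ N * d), one_div_mul_eq_div]
    exact div_le_one_of_le₀ (norm_rowVec_le _) (by positivity)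
  · rw [pieceGrad, norm_smul, Real.norm_eq_abs, abs_of_nonneg hs]
    exact mul_le_one₀ hs1 (norm_nonneg _) (norm_signVec_le _)

end Instances

/-! ### The order in which the keys are met -/

section Chain

variable {d n N B S T : ℕ} (alg : DetAlgorithm d S T) (s γ : ℝ)
  (A : Fin n → Fin d → Fin N) (V : Fin (B + 1) → Fin d → Bool)

/-- At time `t` the answer on the full instance comes from a key of index at least `i`. -/
def KeyHit (i t : ℕ) : Prop :=
  ∃ j : Fin (B + 1), i ≤ j ∧ activePiece (pieceOffset s γ) Finset.univ (pieceGrad s A V)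
    (alg.queryFrom (hardOracle s γ A V Finset.univ) 0 alg.init t) = .inr j

/-- Suppose that the algorithm runs without the keys from `i` on until some time `t₀`, and that key
`i` is revealed then. After at most `m` further queries, it finds a point that is correlated with
key `i` and nearly orthogonal to all rows. The memory at time `t₀` does not depend on key `i`, so it
has to carry information about the rows that are not met in the last phase. -/
def GuessesKey (θ : ℝ) (m : ℕ) (i : Fin B) : Prop :=
  ∃ t₀ < T, ∃ u ≤ m,
    inner ℝ (signVec (V i.castSucc)) (alg.queryFrom (hardOracle s γ A V
      (visiblePieces B ∅ (i + 1))) t₀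
      (alg.memoryFrom (hardOracle s γ A V (visiblePieces B ∅ i)) 0 alg.init t₀) u) ≤ -θ ∧
    ∀ r, |inner ℝ (rowVec (A r)) (alg.queryFrom (hardOracle s γ A V
      (visiblePieces B ∅ (i + 1))) t₀
      (alg.memoryFrom (hardOracle s γ A V (visiblePieces B ∅ i)) 0 alg.init t₀) u)|
      ≤ 4 * s * (N * d)

variable {alg s γ A V}

lemma mem_visiblePieces_of_not_keyHit {i t : ℕ} (h : ¬KeyHit alg s γ A V i t) :
    activePiece (pieceOffset s γ) Finset.univ (pieceGrad s A V)
      (alg.queryFrom (hardOracle s γ A V Finset.univ) 0 alg.init t) ∈ visiblePieces B ∅ i := by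
  rcases hp : activePiece (pieceOffset s γ) Finset.univ (pieceGrad s A V)
      (alg.queryFrom (hardOracle s γ A V Finset.univ) 0 alg.init t) with p | j
  · simp
  · rw [inr_mem_visiblePieces]
    by_contra! hj
    exact h ⟨j, hj, hp⟩

lemma hardOracle_visiblePieces_of_not_keyHit {i t : ℕ} (h : ¬KeyHit alg s γ A V i t) :
    hardOracle s γ A V (visiblePieces B ∅ i)
        (alg.queryFrom (hardOracle s γ A V Finset.univ) 0 alg.init t)
      = hardOracle s γ A V Finset.univ
        (alg.queryFrom (hardOracle s γ A V Finset.univ) 0 alg.init t) :=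
  maxAnswer_eq_of_subset (Finset.subset_univ _) (mem_visiblePieces_of_not_keyHit h)

lemma KeyHit.mono {i i' t : ℕ} (hi : i ≤ i') (h : KeyHit alg s γ A V i' t) :
    KeyHit alg s γ A V i t := by
  obtain ⟨j, hj, hp⟩ := h
  exact ⟨j, hi.trans hj, hp⟩

lemma key_le_hardOracle (x : EuclideanSpace ℝ (Fin d)) (j : Fin (B + 1)) :
    s * (inner ℝ (signVec (V j)) x - j * γ) ≤ (hardOracle s γ A V Finset.univ x).1 := by
  have h := le_maxAnswer (pieceOffset s γ) (pieceGrad s A V) x (Finset.mem_univ (.inr j))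
  simp only [pieceGrad, pieceOffset, real_inner_smul_left] at h
  rw [hardOracle]
  linarith

lemma hardOracle_eq_of_activePiece {x : EuclideanSpace ℝ (Fin d)} {j : Fin (B + 1)}
    (h : activePiece (pieceOffset s γ) Finset.univ (pieceGrad s A V) x = .inr j) :
    (hardOracle s γ A V Finset.univ x).1 = s * (inner ℝ (signVec (V j)) x - j * γ) := by
  rw [hardOracle, maxAnswer, h]
  simp only [pieceGrad, pieceOffset, real_inner_smul_left]
  ring

lemma abs_inner_rowVec_le_hardOracle (hN : 0 < N) (hd : 0 < d) (x : EuclideanSpace ℝ (Fin d))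
    (r : Fin n) :
    |inner ℝ (rowVec (A r)) x| ≤ ((hardOracle s γ A V Finset.univ x).1 + 3 * s) * (N * d) := by
  have h1 := le_maxAnswer (pieceOffset s γ) (pieceGrad s A V) x
    (Finset.mem_univ (.inl (r, true)))
  have h2 := le_maxAnswer (pieceOffset s γ) (pieceGrad s A V) x
    (Finset.mem_univ (.inl (r, false)))
  simp only [pieceGrad, pieceOffset, real_inner_smul_left, if_true, Bool.false_eq_true,
    if_false] at h1 h2
  have hpos : (0 : ℝ) < N * d := by positivity
  rw [← div_le_iff₀ hpos, hardOracle]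
  rcases abs_cases (inner ℝ (rowVec (A r)) x) with ⟨h, _⟩ | ⟨h, _⟩
  · rw [h, div_eq_inv_mul, ← one_div]; linarith
  · rw [h, neg_div, div_eq_inv_mul, ← one_div]
    have : (-1 : ℝ) / (N * d) * inner ℝ (rowVec (A r)) x
      = -(1 / (N * d) * inner ℝ (rowVec (A r)) x) := by ring
    linarith

open Classical in
/-- If in each reduced run the keys that are not visible remain nearly orthogonal to the queries,
and the run finds an `ε`-optimal point, then the keys are met in their order. So for half of the
indices `i` at most `m` queries pass between the first answers by the keys `i` and `i + 1`. The
query answered by key `i + 1` is correlated with key `i` and nearly orthogonal to all rows. -/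
theorem le_two_mul_card_of_isEpsOptimal {κ θ ε : ℝ} {m : ℕ} (hd : 0 < d) (hN : 0 < N) (hs : 0 < s)
    (hκ1 : κ ≤ 1) (hκ0 : 0 ≤ κ) (hκγ : 2 * κ < γ) (hθ : κ - γ ≤ -θ) (hT : 2 * T ≤ B * m)
    (hgood : ∀ i ≤ B, ∀ t ≤ T, ∀ j : Fin (B + 1), i ≤ j → |inner ℝ (signVec (V j))
      (alg.queryFrom (hardOracle s γ A V (visiblePieces B ∅ i)) 0 alg.init t)| ≤ κ)
    (hopt : ∃ y ∈ unitBall d, (hardOracle s γ A V Finset.univ y).1 + ε < s * (-κ - B * γ))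
    (hsucc : IsEpsOptimal (fun x => (hardOracle s γ A V Finset.univ x).1) ε
      (alg.run (fun x => (hardOracle s γ A V Finset.univ x).1)
        (fun x => (hardOracle s γ A V Finset.univ x).2))) :
    B ≤ 2 * (Finset.univ.filter fun i : Fin B => GuessesKey alg s γ A V θ m i).card := by
  classical
  set x : ℕ → EuclideanSpace ℝ (Fin d) := fun t =>
    alg.queryFrom (hardOracle s γ A V Finset.univ) 0 alg.init t with hx
  have hagree : ∀ i U, (∀ t < U, ¬KeyHit alg s γ A V i t) → ∀ t ≤ U,
      alg.queryFrom (hardOracle s γ A V (visiblePieces B ∅ i)) 0 alg.init t = x t :=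
    fun i U h t ht => alg.queryFrom_congr
      (fun u hu => hardOracle_visiblePieces_of_not_keyHit (h u hu)) ht
  obtain ⟨t₁, ht₁, hit₁⟩ : ∃ t < T, KeyHit alg s γ A V B t := by
    by_contra! h
    obtain ⟨y, hy, hyv⟩ := hopt
    have h1 := hsucc.2 y hy
    rw [DetAlgorithm.run_eq_queryFrom] at h1
    have h2 := key_le_hardOracle (s := s) (γ := γ) (A := A) (V := V) (x T) (Fin.last B)
    have h3 := hgood B le_rfl T le_rfl (Fin.last B) le_rfl
    rw [hagree B T h T le_rfl] at h3
    have h4 := (abs_le.mp h3).1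
    have h5 : s * (-κ - B * γ) ≤ s * (inner ℝ (signVec (V (Fin.last B))) (x T)
        - (Fin.last B : ℕ) * γ) := by
      refine mul_le_mul_of_nonneg_left ?_ hs.le
      simp only [Fin.val_last]
      linarith
    linarith
  set D : ℕ → ℕ := fun i => sInf {t | KeyHit alg s γ A V i t} with hD
  have hDhit : ∀ i ≤ B, KeyHit alg s γ A V i (D i) := fun i hi =>
    Nat.sInf_mem (s := {t | KeyHit alg s γ A V i t}) ⟨t₁, hit₁.mono hi⟩
  have hDlt : ∀ i, ∀ t < D i, ¬KeyHit alg s γ A V i t := fun i t ht => Nat.notMem_of_lt_sInf ht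
  have hDT : ∀ i ≤ B, D i < T := fun i hi =>
    (Nat.sInf_le (s := {t | KeyHit alg s γ A V i t}) (hit₁.mono hi)).trans_lt ht₁
  have hDkey : ∀ i : Fin (B + 1), activePiece (pieceOffset s γ) Finset.univ (pieceGrad s A V)
      (x (D i)) = .inr i := by
    intro i
    have hiB : (i : ℕ) ≤ B := by omega
    obtain ⟨j, hij, hj⟩ := hDhit i hiB
    have h1 := hardOracle_eq_of_activePiece hj
    have h2 := key_le_hardOracle (s := s) (γ := γ) (A := A) (V := V) (x (D i)) i
    rw [show (alg.queryFrom (hardOracle s γ A V Finset.univ) 0 alg.init (D i)) = x (D i) from rfl]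
      at h1
    rw [h1] at h2
    have h3 := le_of_mul_le_mul_left h2 hs
    have h4 := hgood i hiB (D i) (hDT i hiB).le i le_rfl
    have h5 := hgood i hiB (D i) (hDT i hiB).le j hij
    rw [hagree i (D i) (hDlt i) _ le_rfl] at h4 h5
    have h6 := (abs_le.mp h4).1
    have h7 := (abs_le.mp h5).2
    have h8 : (j : ℕ) = i := by
      by_contra hne
      have h9 : (i : ℕ) + 1 ≤ j := by omega
      have h10 : ((i : ℕ) : ℝ) + 1 ≤ (j : ℕ) := by exact_mod_cast h9
      nlinarith
    rw [Fin.ext h8] at hj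
    exact hj
  have hDmono : ∀ i < B, D i < D (i + 1) := by
    intro i hi
    have h1 : D i ≤ D (i + 1) := Nat.sInf_le (s := {t | KeyHit alg s γ A V i t})
      ((hDhit (i + 1) hi).mono (Nat.le_succ i))
    refine lt_of_le_of_ne h1 fun heq => ?_
    have h2 := hDkey ⟨i, by omega⟩
    have h3 := hDkey ⟨i + 1, by omega⟩
    simp only [← heq] at h2 h3
    rw [h2] at h3
    simp at h3
  have hshort : ∀ i : Fin B, D (i + 1) ≤ D i + m → GuessesKey alg s γ A V θ m i := by
    intro i him
    have hlt := hDmono i i.2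
    obtain ⟨u, hu⟩ := Nat.exists_eq_add_of_le hlt.le
    refine ⟨D i, hDT i i.2.le, u, by omega, ?_⟩
    have hmem : alg.memoryFrom (hardOracle s γ A V (visiblePieces B ∅ i)) 0 alg.init (D i)
        = alg.memoryFrom (hardOracle s γ A V Finset.univ) 0 alg.init (D i) :=
      alg.memoryFrom_congr
        (fun t ht => hardOracle_visiblePieces_of_not_keyHit (hDlt i t ht)) _ le_rfl
    have hq : alg.queryFrom (hardOracle s γ A V (visiblePieces B ∅ (i + 1))) (D i)
        (alg.memoryFrom (hardOracle s γ A V (visiblePieces B ∅ i)) 0 alg.init (D i)) u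
        = x (D (i + 1)) := by
      rw [hmem, hu]
      have hadd : ∀ u', alg.queryFrom (hardOracle s γ A V Finset.univ) (D i)
          (alg.memoryFrom (hardOracle s γ A V Finset.univ) 0 alg.init (D i)) u'
          = x (D i + u') := fun u' => by
        simp only [hx]; rw [alg.queryFrom_add, zero_add]
      rw [← hadd]
      refine alg.queryFrom_congr (U := u) (fun u' hu' => ?_) le_rfl
      rw [hadd]
      exact hardOracle_visiblePieces_of_not_keyHit (hDlt _ _ (by omega))
    rw [hq]
    have hkey := hDkey i.succ
    rw [Fin.val_succ] at hkey
    have hval := hardOracle_eq_of_activePiece hkey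
    have hg := hgood (i + 1) i.2 (D (i + 1)) (hDT _ i.2).le i.succ (by simp)
    rw [hagree _ _ (hDlt _) _ le_rfl] at hg
    have hg2 := (abs_le.mp hg).2
    constructor
    · have h2 := key_le_hardOracle (s := s) (γ := γ) (A := A) (V := V) (x (D (i + 1)))
        i.castSucc
      rw [hval] at h2
      have h3 := le_of_mul_le_mul_left h2 hs
      rw [Fin.val_succ, Fin.val_castSucc] at h3
      push_cast at h3
      linarith
    · intro r
      refine (abs_inner_rowVec_le_hardOracle (s := s) (γ := γ) (V := V) hN hd _ r).trans ?_
      refine mul_le_mul_of_nonneg_right ?_ (by positivity)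
      rw [hval]
      have h3 : inner ℝ (signVec (V i.succ)) (x (D (i + 1))) - (i.succ : ℕ) * γ ≤ 1 := by
        have : 0 ≤ ((i.succ : ℕ) : ℝ) * γ := mul_nonneg (Nat.cast_nonneg _) (by linarith)
        linarith
      have := mul_le_mul_of_nonneg_left h3 hs.le
      linarith
  -- the lengths of the phases add up to less than `T`
  have hsum : ∑ i : Fin B, (D (i + 1) - D i) ≤ T := by
    have h1 : ∀ k ≤ B, D 0 + ∑ i ∈ Finset.range k, (D (i + 1) - D i) = D k := by
      intro k
      induction k with
      | zero => intro _; simp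
      | succ k ih =>
        intro hk
        have := hDmono k hk
        rw [Finset.sum_range_succ, ← add_assoc, ih (by omega)]
        omega
    have h2 := h1 B le_rfl
    have h3 := hDT B le_rfl
    rw [Fin.sum_univ_eq_sum_range (fun i => D (i + 1) - D i)]
    omega
  have hlong : (Finset.univ.filter fun i : Fin B => ¬D (i + 1) ≤ D i + m).card * (m + 1) ≤ T := by
    refine le_trans ?_ hsum
    rw [← smul_eq_mul]
    refine (Finset.card_nsmul_le_sum _ (fun i : Fin B => D (i + 1) - D i) _ ?_).trans
      (Finset.sum_le_sum_of_subset (Finset.filter_subset _ _))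
    intro i hi
    have := (Finset.mem_filter.mp hi).2
    omega
  have hcard := Finset.card_filter_add_card_filter_not (s := (Finset.univ : Finset (Fin B)))
    (fun i : Fin B => D (i + 1) ≤ D i + m)
  rw [Finset.card_univ, Fintype.card_fin] at hcard
  have h1 : 2 * (Finset.univ.filter fun i : Fin B => ¬D (i + 1) ≤ D i + m).card ≤ B := by
    have : 2 * (Finset.univ.filter fun i : Fin B => ¬D (i + 1) ≤ D i + m).card * (m + 1)
        ≤ B * (m + 1) := by nlinarith
    exact Nat.le_of_mul_le_mul_right this (Nat.succ_pos m)
  have h2 := Finset.card_le_card (s := Finset.univ.filter fun i : Fin B => D (i + 1) ≤ D i + m)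
    (t := Finset.univ.filter fun i : Fin B => GuessesKey alg s γ A V θ m i)
    (fun i hi => Finset.mem_filter.mpr ⟨Finset.mem_univ _,
      hshort i (Finset.mem_filter.mp hi).2⟩)
  omega

end Chain

/-! ### A point of small value -/

section Optimum

variable {d n N B : ℕ}

/-- The scaled negative sum of the projections of the keys to the orthogonal complement of the rows
is a point of small value, if the keys are in general position. -/
lemma exists_orthogonal_and_inner_signVec_le {κ : ℝ} (hκ : 8 * (B + 1) * κ ≤ 1)
    (U : Submodule ℝ (EuclideanSpace ℝ (Fin d))) (hd : 0 < d) (V : Fin (B + 1) → Fin d → Bool)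
    (hU : ∀ l, ‖U.starProjection (signVec (V l))‖ ^ 2 ≤ 3 / 4)
    (hV : ∀ j l, j ≠ l →
      |inner ℝ (signVec (V j)) (signVec (V l) - U.starProjection (signVec (V l)))| ≤ κ) :
    ∃ y ∈ unitBall d, (∀ a ∈ U, inner ℝ a y = 0) ∧
      ∀ l, inner ℝ (signVec (V l)) y ≤ -(1 / (8 * √(2 * (B + 1)))) := by
  set v : Fin (B + 1) → EuclideanSpace ℝ (Fin d) := fun j => signVec (V j) with hv
  set p : Fin (B + 1) → EuclideanSpace ℝ (Fin d) := fun j => v j - U.starProjection (v j) with hp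
  have horth : ∀ a ∈ U, ∀ j, inner ℝ a (p j) = 0 := fun a ha j =>
    (Submodule.mem_orthogonal U _).mp (Submodule.sub_starProjection_mem_orthogonal (v j)) a ha
  have hinner : ∀ j l, inner ℝ (p j) (p l) = inner ℝ (v j) (p l) := fun j l => by
    rw [hp]
    simp only
    rw [inner_sub_left, horth _ (U.starProjection_apply_mem _) l, sub_zero]
  have hpp : ∀ l, 1 / 4 ≤ inner ℝ (v l) (p l) ∧ inner ℝ (v l) (p l) ≤ 1 := by
    intro l
    have h1 : ‖v l‖ = 1 := norm_signVec hd _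
    have h2 : inner ℝ (v l) (p l) = 1 - ‖U.starProjection (v l)‖ ^ 2 := by
      have h3 : inner ℝ (U.starProjection (v l)) (v l) = ‖U.starProjection (v l)‖ ^ 2 := by
        have := horth _ (U.starProjection_apply_mem (v l)) l
        rw [hp] at this
        simp only [inner_sub_right, real_inner_self_eq_norm_sq] at this
        linarith
      rw [hp]
      simp only
      rw [inner_sub_right, real_inner_self_eq_norm_sq, h1, real_inner_comm, h3]
      norm_num
    have := hU l
    have h4 := sq_nonneg ‖U.starProjection (v l)‖
    rw [h2]
    constructor <;> linarith
  have hoff : ∀ l, |∑ j ∈ Finset.univ.erase l, inner ℝ (v l) (p j)| ≤ 1 / 8 := by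
    intro l
    refine (Finset.abs_sum_le_sum_abs _ _).trans ?_
    have h1 : ∑ j ∈ Finset.univ.erase l, |inner ℝ (v l) (p j)|
        ≤ ∑ _j ∈ Finset.univ.erase l, 1 / (8 * (B + 1) : ℝ) := by
      refine Finset.sum_le_sum fun j hj => ?_
      refine (hV l j (Finset.ne_of_mem_erase hj).symm).trans ?_
      rw [le_div_iff₀ (by positivity)]
      linarith
    refine h1.trans ?_
    have h2 : (Finset.univ.erase l).card ≤ B := by
      rw [Finset.card_erase_of_mem (Finset.mem_univ _), Finset.card_univ, Fintype.card_fin]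
      omega
    have h3 : ((Finset.univ.erase l).card : ℝ) ≤ B := by exact_mod_cast h2
    rw [Finset.sum_const, nsmul_eq_mul, mul_one_div, div_le_div_iff₀ (by positivity) (by norm_num)]
    linarith
  have hsum : ∀ l, inner ℝ (v l) (∑ j, p j)
      = inner ℝ (v l) (p l) + ∑ j ∈ Finset.univ.erase l, inner ℝ (v l) (p j) := fun l => by
    
    rw [inner_sum]
    exact (Finset.add_sum_erase _ (fun j => inner ℝ (v l) (p j)) (Finset.mem_univ l)).symm
  have hsq : (0 : ℝ) < √(2 * (B + 1)) := Real.sqrt_pos.mpr (by positivity)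
  have hnorm : ‖∑ j, p j‖ ≤ √(2 * (B + 1)) := by
    refine Real.le_sqrt_of_sq_le ?_
    rw [← real_inner_self_eq_norm_sq, sum_inner]
    have h1 : ∀ j ∈ Finset.univ, inner ℝ (p j) (∑ i, p i) ≤ 2 := by
      intro j _
      have h2 : inner ℝ (p j) (∑ i, p i) = inner ℝ (v j) (∑ i, p i) := by
        simp only [inner_sum, hinner]
      rw [h2, hsum]
      have := (abs_le.mp (hoff j)).2
      linarith [(hpp j).2]
    refine (Finset.sum_le_card_nsmul _ _ _ h1).trans ?_
    rw [Finset.card_univ, Fintype.card_fin, nsmul_eq_mul]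
    push_cast
    linarith
  refine ⟨-(√(2 * (B + 1)))⁻¹ • ∑ j, p j, ?_, fun a ha => ?_, fun l => ?_⟩
  · rw [mem_closedBall_zero_iff, norm_smul, norm_neg, norm_inv, Real.norm_eq_abs,
      abs_of_pos hsq, inv_mul_le_iff₀ hsq, mul_one]
    exact hnorm
  · rw [real_inner_smul_right, inner_sum, Finset.sum_eq_zero fun j _ => horth a ha j, mul_zero]
  · change inner ℝ (v l) _ ≤ _
    rw [real_inner_smul_right, hsum]
    have h1 := (abs_le.mp (hoff l)).1
    have h2 := (hpp l).1
    have h3 : 1 / 8 ≤ inner ℝ (v l) (p l) + ∑ j ∈ Finset.univ.erase l, inner ℝ (v l) (p j) := by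
      linarith
    have h4 := mul_le_mul_of_nonneg_left h3 (inv_pos.mpr hsq).le
    have h5 : (√(2 * (B + 1)))⁻¹ * (1 / 8) = 1 / (8 * √(2 * (B + 1))) := by
      field_simp
    rw [← h5]
    linarith

/-- The value of the hard function at a point orthogonal to the rows. -/
lemma hardOracle_le_of_orthogonal {s γ ν : ℝ} (hs : 0 ≤ s) (hγ : 0 ≤ γ) (hν : ν ≤ 3)
    {A : Fin n → Fin d → Fin N} {V : Fin (B + 1) → Fin d → Bool} {y : EuclideanSpace ℝ (Fin d)}
    (hA : ∀ r, inner ℝ (rowVec (A r)) y = 0) (hV : ∀ l, inner ℝ (signVec (V l)) y ≤ -ν) :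
    (hardOracle s γ A V Finset.univ y).1 ≤ -(s * ν) := by
  rw [hardOracle, maxAnswer]
  rcases activePiece (pieceOffset s γ) Finset.univ (pieceGrad s A V) y with p | l
  · simp only [pieceGrad, pieceOffset, real_inner_smul_left, hA, mul_zero, zero_add]
    nlinarith
  · simp only [pieceGrad, pieceOffset, real_inner_smul_left]
    have h1 := mul_le_mul_of_nonneg_left (hV l) hs
    have h2 : 0 ≤ s * ((l : ℕ) * γ) := by positivity
    linarith

end Optimum

/-! ### Counting instances -/

section Counting

/-- Averaging over all families is the same as averaging over all families with one coordinate
resampled. -/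
lemma sum_sum_update {κ X : Type*} [Fintype κ] [DecidableEq κ] [Fintype X] (j : κ)
    (g : (κ → X) → ℝ) :
    ∑ V, ∑ x, g (Function.update V j x) = Fintype.card X * ∑ V, g V := by
  classical
  have hinv : Function.Involutive fun p : (κ → X) × X => (Function.update p.1 j p.2, p.1 j) := by
    rintro ⟨V, x⟩
    simp
  have h := Equiv.sum_comp hinv.toPerm fun p : (κ → X) × X => g p.1
  simp only [Function.Involutive.coe_toPerm, Fintype.sum_prod_type] at h
  rw [h, Finset.mul_sum]
  exact Finset.sum_congr rfl fun V _ => by simp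

lemma card_filter_le_of_update {κ X : Type*} [Fintype κ] [DecidableEq κ] [Fintype X]
    (hX : 0 < Fintype.card X) (j : κ) (P : (κ → X) → Prop) [DecidablePred P] {c : ℝ}
    (h : ∀ V, ((Finset.univ.filter fun x => P (Function.update V j x)).card : ℝ)
      ≤ c * Fintype.card X) :
    ((Finset.univ.filter P).card : ℝ) ≤ c * Fintype.card (κ → X) := by
  have h1 := sum_sum_update j fun V : κ → X => if P V then (1 : ℝ) else 0
  simp only [Finset.sum_boole] at h1
  have h2 := Finset.sum_le_sum fun V (_ : V ∈ (Finset.univ : Finset (κ → X))) => h V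
  rw [h1, Finset.sum_const, Finset.card_univ, nsmul_eq_mul] at h2
  have h3 : (0 : ℝ) < Fintype.card X := by exact_mod_cast hX
  refine le_of_mul_le_mul_left (h2.trans (le_of_eq ?_)) h3
  ring

lemma card_filter_exists_le {I Ω : Type*} [Fintype I] [Fintype Ω] (P : I → Ω → Prop)
    [∀ i, DecidablePred (P i)] [DecidablePred fun ω => ∃ i, P i ω] {c : ℝ}
    (h : ∀ i, ((Finset.univ.filter (P i)).card : ℝ) ≤ c) :
    ((Finset.univ.filter fun ω => ∃ i, P i ω).card : ℝ) ≤ Fintype.card I * c := by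
  classical
  have h1 : (Finset.univ.filter fun ω => ∃ i, P i ω)
      = Finset.univ.biUnion fun i => Finset.univ.filter (P i) := by
    ext ω; simp
  rw [h1]
  calc ((Finset.univ.biUnion fun i => Finset.univ.filter (P i)).card : ℝ)
      ≤ ∑ i, ((Finset.univ.filter (P i)).card : ℝ) := by exact_mod_cast Finset.card_biUnion_le
    _ ≤ ∑ _i : I, c := Finset.sum_le_sum fun i _ => h i
    _ = _ := by rw [Finset.sum_const, Finset.card_univ, nsmul_eq_mul]

lemma card_lt_abs_inner_signVec_le {d : ℕ} (hd : 0 < d) {x : EuclideanSpace ℝ (Fin d)}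
    (hx : ‖x‖ ≤ 1) {κ : ℝ} (hκ : 0 ≤ κ) :
    ((Finset.univ.filter fun v : Fin d → Bool => κ < |inner ℝ (signVec v) x|).card : ℝ)
      ≤ √2 * Real.exp (-(d * κ ^ 2 / 4)) * 2 ^ d := by
  have hr : Module.finrank ℝ (Submodule.span ℝ {x}) ≤ 1 := by
    simpa using finrank_span_le_card (R := ℝ) ({x} : Set (EuclideanSpace ℝ (Fin d)))
  have h := card_le_norm_proj_signVec_le hd (Submodule.span ℝ {x}) hr hκ
  rw [pow_one] at h
  refine le_trans (Nat.cast_le.mpr (Finset.card_le_card fun v hv => ?_)) h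
  refine Finset.mem_filter.mpr ⟨Finset.mem_univ _, ?_⟩
  have hv' := (Finset.mem_filter.mp hv).2
  have h0 := le_norm_starProjection_of_norm_sub_lt (U := Submodule.span ℝ {x})
    (norm_signVec_le v) hx (θ := |inner ℝ (signVec v) x|)
    (ρ := |inner ℝ (signVec v) x| - κ) le_rfl
    (Submodule.mem_span_singleton_self x) (by rw [sub_self, norm_zero]; linarith)
  linarith

end Counting

section GeneralPosition

variable {d n N B S T : ℕ}

lemma hardOracle_congr {s γ : ℝ} {A A' : Fin n → Fin d → Fin N}
    {V V' : Fin (B + 1) → Fin d → Bool} {Q : Finset (Fin n)} {i : ℕ}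
    (hP : (visiblePieces B Q i).Nonempty) (hA : ∀ r ∉ Q, A r = A' r)
    (hV : ∀ j : Fin (B + 1), (j : ℕ) < i → V j = V' j) :
    hardOracle s γ A V (visiblePieces B Q i) = hardOracle s γ A' V' (visiblePieces B Q i) := by
  refine maxAnswer_congr hP ?_
  rintro (p | j) hp
  · rw [pieceGrad, pieceGrad, hA _ (inl_mem_visiblePieces.mp hp)]
  · rw [pieceGrad, pieceGrad, hV _ (inr_mem_visiblePieces.mp hp)]

lemma visiblePieces_empty_nonempty (hn : 0 < n) (i : ℕ) :
    (visiblePieces B (∅ : Finset (Fin n)) i).Nonempty :=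
  ⟨.inl (⟨0, hn⟩, true), by simp⟩

/-- The keys are in general position for the matrix `A` and the algorithm: they are far from the
span of the rows, nearly orthogonal to one another modulo the rows, and nearly orthogonal to the
queries of each run in which they are not visible. -/
def GeneralPosition (alg : DetAlgorithm d S T) (s γ κ : ℝ) (A : Fin n → Fin d → Fin N)
    (V : Fin (B + 1) → Fin d → Bool) : Prop :=
  (∀ l, ‖(Submodule.span ℝ (Set.range fun r => rowVec (A r))).starProjection
    (signVec (V l))‖ ^ 2 ≤ 3 / 4) ∧
  (∀ j l, j ≠ l → |inner ℝ (signVec (V j)) (signVec (V l) -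
    (Submodule.span ℝ (Set.range fun r => rowVec (A r))).starProjection (signVec (V l)))| ≤ κ) ∧
  ∀ i ≤ B, ∀ t ≤ T, ∀ j : Fin (B + 1), i ≤ j → |inner ℝ (signVec (V j))
    (alg.queryFrom (hardOracle s γ A V (visiblePieces B ∅ i)) 0 alg.init t)| ≤ κ

open Classical in
lemma card_not_generalPosition_le (alg : DetAlgorithm d S T) (s γ : ℝ) {κ : ℝ} (hκ : 0 ≤ κ)
    (hd : 0 < d) (hn : 0 < n) (A : Fin n → Fin d → Fin N) :
    ((Finset.univ.filter fun V : Fin (B + 1) → Fin d → Bool =>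
        ¬GeneralPosition alg s γ κ A V).card : ℝ)
      ≤ ((B + 1) * (√2 ^ n * Real.exp (-(d * (3 / 16)))) +
        (B + 1) ^ 2 * (T + 2) * (√2 * Real.exp (-(d * κ ^ 2 / 4)))) *
        Fintype.card (Fin (B + 1) → Fin d → Bool) := by
  set U := Submodule.span ℝ (Set.range fun r => rowVec (A r)) with hU
  set c₁ := √2 ^ n * Real.exp (-(d * (3 / 16)))
  set c₂ := √2 * Real.exp (-(d * κ ^ 2 / 4))
  set C : ℝ := ((Fintype.card (Fin (B + 1) → Fin d → Bool) : ℕ) : ℝ)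
  have hX : 0 < Fintype.card (Fin d → Bool) := Fintype.card_pos
  have hXc : (Fintype.card (Fin d → Bool) : ℝ) = 2 ^ d := by simp
  have hfin : Module.finrank ℝ U ≤ n := by
    exact (finrank_range_le_card (R := ℝ) fun r => rowVec (A r)).trans (Fintype.card_fin n).le
  have h1 : ((Finset.univ.filter fun V : Fin (B + 1) → Fin d → Bool =>
      ∃ l, 3 / 4 < ‖U.starProjection (signVec (V l))‖ ^ 2).card : ℝ)
      ≤ Fintype.card (Fin (B + 1)) * (c₁ * C) := by
    refine card_filter_exists_le (fun l V => _) fun l => card_filter_le_of_update hX l _ fun V => ?_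
    simp only [Function.update_self]
    rw [hXc]
    have h := card_le_norm_proj_signVec_le hd U hfin (t := √(3 / 4)) (Real.sqrt_nonneg _)
    rw [Real.sq_sqrt (by norm_num), show (d : ℝ) * (3 / 4) / 4 = d * (3 / 16) by ring] at h
    refine le_trans (Nat.cast_le.mpr (Finset.card_le_card fun v hv => ?_)) h
    refine Finset.mem_filter.mpr ⟨Finset.mem_univ _, ?_⟩
    exact Real.sqrt_le_iff.mpr ⟨norm_nonneg _, (Finset.mem_filter.mp hv).2.le⟩
  have h2 : ((Finset.univ.filter fun V : Fin (B + 1) → Fin d → Bool =>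
      ∃ p : Fin (B + 1) × Fin (B + 1), p.1 ≠ p.2 ∧ κ < |inner ℝ (signVec (V p.1))
        (signVec (V p.2) - U.starProjection (signVec (V p.2)))|).card : ℝ)
      ≤ Fintype.card (Fin (B + 1) × Fin (B + 1)) * (c₂ * C) := by
    refine card_filter_exists_le (fun p V => _) fun p => card_filter_le_of_update hX p.1 _ fun V => ?_
    rw [hXc]
    by_cases hp : p.1 = p.2
    · simp only [hp, ne_eq, not_true_eq_false, false_and, Finset.filter_false, Finset.card_empty,
        Nat.cast_zero]
      positivity
    · simp only [Function.update_self, Function.update_of_ne (Ne.symm hp), ne_eq, hp,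
        not_false_eq_true, true_and]
      refine card_lt_abs_inner_signVec_le hd ?_ hκ
      have h4 : signVec (V p.2) - U.starProjection (signVec (V p.2))
          = Uᗮ.starProjection (signVec (V p.2)) := by
        rw [Submodule.starProjection_orthogonal']
        simp
      rw [h4]
      exact (Uᗮ.norm_starProjection_apply_le _).trans (norm_signVec_le _)
  have h3 : ((Finset.univ.filter fun V : Fin (B + 1) → Fin d → Bool =>
      ∃ p : Fin (B + 1) × Fin (T + 1) × Fin (B + 1), p.1 ≤ p.2.2 ∧
        κ < |inner ℝ (signVec (V p.2.2)) (alg.queryFrom (hardOracle s γ A V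
          (visiblePieces B ∅ p.1)) 0 alg.init p.2.1)|).card : ℝ)
      ≤ Fintype.card (Fin (B + 1) × Fin (T + 1) × Fin (B + 1)) * (c₂ * C) := by
    refine card_filter_exists_le (fun p V => _) fun p => card_filter_le_of_update hX p.2.2 _ fun V => ?_
    rw [hXc]
    refine le_trans (Nat.cast_le.mpr (Finset.card_le_card fun v hv => ?_))
      (card_lt_abs_inner_signVec_le hd (x := alg.queryFrom (hardOracle s γ A V
          (visiblePieces B ∅ p.1)) 0 alg.init p.2.1) (alg.norm_queryFrom_le _ _ _ _) hκ)
    obtain ⟨hp, hv'⟩ := (Finset.mem_filter.mp hv).2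
    refine Finset.mem_filter.mpr ⟨Finset.mem_univ _, ?_⟩
    rw [Function.update_self, hardOracle_congr (V' := V) (visiblePieces_empty_nonempty hn _)
      (fun _ _ => rfl) fun j hj => Function.update_of_ne (by
        rintro rfl
        exact absurd hj (not_lt.mpr hp)) _ _] at hv'
    exact hv'
  have hsub : (Finset.univ.filter fun V : Fin (B + 1) → Fin d → Bool =>
        ¬GeneralPosition alg s γ κ A V)
      ⊆ (Finset.univ.filter fun V : Fin (B + 1) → Fin d → Bool =>
          ∃ l, 3 / 4 < ‖U.starProjection (signVec (V l))‖ ^ 2) ∪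
        ((Finset.univ.filter fun V : Fin (B + 1) → Fin d → Bool =>
          ∃ p : Fin (B + 1) × Fin (B + 1), p.1 ≠ p.2 ∧ κ < |inner ℝ (signVec (V p.1))
            (signVec (V p.2) - U.starProjection (signVec (V p.2)))|) ∪
        (Finset.univ.filter fun V : Fin (B + 1) → Fin d → Bool =>
          ∃ p : Fin (B + 1) × Fin (T + 1) × Fin (B + 1), p.1 ≤ p.2.2 ∧
            κ < |inner ℝ (signVec (V p.2.2)) (alg.queryFrom (hardOracle s γ A V
              (visiblePieces B ∅ p.1)) 0 alg.init p.2.1)|)) := by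
    intro V hV
    have hV' := (Finset.mem_filter.mp hV).2
    simp only [Finset.mem_union, Finset.mem_filter, Finset.mem_univ, true_and]
    by_contra! hcon
    obtain ⟨k1, k2, k3⟩ := hcon
    refine hV' ⟨k1, fun j l hjl => k2 (j, l) hjl, fun i hi t ht j hij => ?_⟩
    exact k3 (⟨i, by omega⟩, ⟨t, by omega⟩, j) hij
  have h4 := (Finset.card_le_card hsub).trans ((Finset.card_union_le _ _).trans
    (Nat.add_le_add_left (Finset.card_union_le _ _) _))
  refine (Nat.cast_le.mpr h4).trans ?_
  push_cast
  simp only [Fintype.card_prod, Fintype.card_fin] at h1 h2 h3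
  push_cast at h1 h2 h3
  refine (add_le_add h1 (add_le_add h2 h3)).trans (le_of_eq ?_)
  ring

end GeneralPosition

/-! ### The bound for finite parameters -/

section Finite

variable {d n N B S T : ℕ}

open Classical in
/-- Some key is guessed on a quarter of all instances. -/
lemma exists_le_card_guessesKey (alg : DetAlgorithm d S T) {s γ κ θ ε : ℝ} {m : ℕ} (hd : 0 < d)
    (hN : 0 < N) (hn : 0 < n) (hB : 0 < B) (hs : 0 < s) (hκ0 : 0 ≤ κ)
    (hκB : 8 * (B + 1) * κ ≤ 1) (hκγ : 2 * κ < γ) (hθ : κ - γ ≤ -θ) (hT : 2 * T ≤ B * m)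
    (hbad : (B + 1) * (√2 ^ n * Real.exp (-(d * (3 / 16)))) +
        (B + 1) ^ 2 * (T + 2) * (√2 * Real.exp (-(d * κ ^ 2 / 4))) ≤ 1 / 6)
    (hε : ε < s * (1 / (8 * √(2 * (B + 1))) - κ - B * γ))
    (W : Finset ((Fin n → Fin d → Fin N) × (Fin (B + 1) → Fin d → Bool)))
    (hWc : (2 / 3 : ℝ) *
      Fintype.card ((Fin n → Fin d → Fin N) × (Fin (B + 1) → Fin d → Bool)) ≤ W.card)
    (hW : ∀ ω ∈ W, IsEpsOptimal (fun x => (hardOracle s γ ω.1 ω.2 Finset.univ x).1) ε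
      (alg.run (fun x => (hardOracle s γ ω.1 ω.2 Finset.univ x).1)
        (fun x => (hardOracle s γ ω.1 ω.2 Finset.univ x).2))) :
    ∃ i : Fin B, (1 / 4 : ℝ) *
        Fintype.card ((Fin n → Fin d → Fin N) × (Fin (B + 1) → Fin d → Bool))
      ≤ (Finset.univ.filter fun ω : (Fin n → Fin d → Fin N) × (Fin (B + 1) → Fin d → Bool) =>
        GuessesKey alg s γ ω.1 ω.2 θ m i).card := by
  set C : ℝ := ((Fintype.card ((Fin n → Fin d → Fin N) × (Fin (B + 1) → Fin d → Bool)) : ℕ) : ℝ)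
    with hC
  set P : Finset ((Fin n → Fin d → Fin N) × (Fin (B + 1) → Fin d → Bool)) :=
    Finset.univ.filter fun ω => GeneralPosition alg s γ κ ω.1 ω.2 with hP
  have hPc : ((Finset.univ.filter fun ω : (Fin n → Fin d → Fin N) × (Fin (B + 1) → Fin d → Bool) =>
      ¬GeneralPosition alg s γ κ ω.1 ω.2).card : ℝ) ≤ 1 / 6 * C := by
    have h1 : ((Finset.univ.filter fun ω : (Fin n → Fin d → Fin N) ×
        (Fin (B + 1) → Fin d → Bool) => ¬GeneralPosition alg s γ κ ω.1 ω.2).card : ℝ)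
        = ∑ A : Fin n → Fin d → Fin N, ((Finset.univ.filter fun V : Fin (B + 1) → Fin d → Bool =>
          ¬GeneralPosition alg s γ κ A V).card : ℝ) := by
      rw [Finset.card_filter, Fintype.sum_prod_type]
      push_cast
      exact Finset.sum_congr rfl fun A _ => by rw [Finset.card_filter]; push_cast; rfl
    rw [h1]
    calc _ ≤ ∑ _A : Fin n → Fin d → Fin N,
          (1 / 6 : ℝ) * Fintype.card (Fin (B + 1) → Fin d → Bool) :=
          Finset.sum_le_sum fun A _ =>
            (card_not_generalPosition_le alg s γ hκ0 hd hn A).trans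
              (mul_le_mul_of_nonneg_right hbad (Nat.cast_nonneg _))
      _ = 1 / 6 * C := by
          rw [Finset.sum_const, Finset.card_univ, nsmul_eq_mul, hC, Fintype.card_prod]
          push_cast
          ring
  have hWP : (1 / 2 : ℝ) * C ≤ (W ∩ P).card := by
    have h1 : W.card ≤ (W ∩ P).card + (Finset.univ.filter fun ω :
        (Fin n → Fin d → Fin N) × (Fin (B + 1) → Fin d → Bool) =>
        ¬GeneralPosition alg s γ κ ω.1 ω.2).card := by
      refine le_trans (Finset.card_le_card fun ω hω => ?_) (Finset.card_union_le _ _)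
      by_cases h : GeneralPosition alg s γ κ ω.1 ω.2
      · exact Finset.mem_union_left _ (Finset.mem_inter.mpr
          ⟨hω, Finset.mem_filter.mpr ⟨Finset.mem_univ _, h⟩⟩)
      · exact Finset.mem_union_right _ (Finset.mem_filter.mpr ⟨Finset.mem_univ _, h⟩)
    have h2 : (W.card : ℝ) ≤ (W ∩ P).card + (Finset.univ.filter fun ω :
        (Fin n → Fin d → Fin N) × (Fin (B + 1) → Fin d → Bool) =>
        ¬GeneralPosition alg s γ κ ω.1 ω.2).card := by exact_mod_cast h1
    linarith
  have hκ1 : κ ≤ 1 := by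
    have h1 : 0 ≤ (B : ℝ) * κ := by positivity
    nlinarith
  have hmany : ∀ ω ∈ W ∩ P, B ≤ 2 * (Finset.univ.filter fun i : Fin B =>
      GuessesKey alg s γ ω.1 ω.2 θ m i).card := by
    intro ω hω
    obtain ⟨hωW, hωP⟩ := Finset.mem_inter.mp hω
    obtain ⟨g1, g2, g3⟩ := (Finset.mem_filter.mp hωP).2
    refine le_two_mul_card_of_isEpsOptimal hd hN hs hκ1 hκ0 hκγ hθ hT g3 ?_ (hW ω hωW)
    obtain ⟨y, hy, hyA, hyV⟩ := exists_orthogonal_and_inner_signVec_le hκB _ hd ω.2 g1 g2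
    refine ⟨y, hy, ?_⟩
    have h1 : (1 : ℝ) / (8 * √(2 * (B + 1))) ≤ 3 := by
      rw [div_le_iff₀ (by positivity)]
      have : (1 : ℝ) ≤ √(2 * (B + 1)) := Real.one_le_sqrt.mpr (by
        have : (0 : ℝ) ≤ B := Nat.cast_nonneg _
        linarith)
      linarith
    have h2 := hardOracle_le_of_orthogonal (γ := γ) hs.le (by linarith) h1 (A := ω.1)
      (fun r => hyA _ (Submodule.subset_span ⟨r, rfl⟩)) hyV
    linarith
  by_contra! hcon
  have h1 : ∑ ω : (Fin n → Fin d → Fin N) × (Fin (B + 1) → Fin d → Bool),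
      (Finset.univ.filter fun i : Fin B => GuessesKey alg s γ ω.1 ω.2 θ m i).card
      = ∑ i : Fin B, (Finset.univ.filter fun ω : (Fin n → Fin d → Fin N) ×
        (Fin (B + 1) → Fin d → Bool) => GuessesKey alg s γ ω.1 ω.2 θ m i).card := by
    simp only [Finset.card_filter]
    exact Finset.sum_comm
  have h2 : (W ∩ P).card * B ≤ 2 * ∑ ω : (Fin n → Fin d → Fin N) × (Fin (B + 1) → Fin d → Bool),
      (Finset.univ.filter fun i : Fin B => GuessesKey alg s γ ω.1 ω.2 θ m i).card := by
    rw [← smul_eq_mul, Finset.mul_sum]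
    exact (Finset.card_nsmul_le_sum _ _ _ hmany).trans
      (Finset.sum_le_sum_of_subset (Finset.subset_univ _))
  rw [h1] at h2
  have h3 : ((W ∩ P).card : ℝ) * B ≤ 2 * ∑ i : Fin B, ((Finset.univ.filter fun ω :
      (Fin n → Fin d → Fin N) × (Fin (B + 1) → Fin d → Bool) =>
        GuessesKey alg s γ ω.1 ω.2 θ m i).card : ℝ) := by exact_mod_cast h2
  have hne : (Finset.univ : Finset (Fin B)).Nonempty := ⟨⟨0, hB⟩, Finset.mem_univ _⟩
  have h4 := Finset.sum_lt_sum_of_nonempty hne fun i _ => hcon i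
  rw [Finset.sum_const, Finset.card_univ, Fintype.card_fin, nsmul_eq_mul] at h4
  have h5 : (1 / 2 : ℝ) * C * B ≤ (W ∩ P).card * B :=
    mul_le_mul_of_nonneg_right hWP (Nat.cast_nonneg _)
  linarith

open Classical in
/-- If some key is guessed on a quarter of all instances, then the memory is large. The messages of
the cell sampling bound are the memory contents at the time at which the key is revealed, and the
labels are this time, the number of further queries, and a set of rows not met meanwhile. -/
lemma pow_le_of_guessesKey (alg : DetAlgorithm d S T) {s γ θ ρ σ L : ℝ} {m b k₀ : ℕ} (hd : 0 < d)
    (hN : 0 < N) (hn : 0 < n) (hs : 0 < s) (hmb : m + b ≤ n) (hk : k₀ ≤ d) (hk0 : 0 < k₀)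
    (hρ : 0 < ρ) (hσ : 0 < σ) (hσρ : σ * d ^ 2 < ρ ^ 2)
    (hτσ : 4 * d * (4 * s * (N * d)) < σ) (hρθ : ρ ≤ θ / 2) (hL : 0 < L)
    (hLc : (T * ((m + 1) * n.choose b) : ℝ) ≤ L)
    (hf : √2 ^ (k₀ + k₀) * Real.exp (-(d * θ ^ 2 / 16)) ≤ 1 / (16 * L)) (i : Fin B)
    (hi : (1 / 4 : ℝ) * Fintype.card ((Fin n → Fin d → Fin N) × (Fin (B + 1) → Fin d → Bool))
      ≤ (Finset.univ.filter fun ω : (Fin n → Fin d → Fin N) × (Fin (B + 1) → Fin d → Bool) =>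
        GuessesKey alg s γ ω.1 ω.2 θ m i).card) :
    (N : ℝ) ^ (k₀ * b) ≤ 8 * L * (16 * L) ^ (k₀ + k₀) * 2 ^ S := by
  have : NeZero N := ⟨hN.ne'⟩
  set cA : ℝ := ((Fintype.card (Fin n → Fin d → Fin N) : ℕ) : ℝ) with hcA
  have hcA0 : 0 < cA := Nat.cast_pos.mpr Fintype.card_pos
  have hcX : (Fintype.card (Fin d → Bool) : ℝ) = 2 ^ d := by simp
  -- the other keys are fixed by averaging
  obtain ⟨V, hV⟩ : ∃ V : Fin (B + 1) → Fin d → Bool, (1 / 4 : ℝ) * cA * 2 ^ d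
      ≤ ∑ A : Fin n → Fin d → Fin N, ((Finset.univ.filter fun v : Fin d → Bool =>
        GuessesKey alg s γ A (Function.update V i.castSucc v) θ m i).card : ℝ) := by
    have h1 : ∑ V : Fin (B + 1) → Fin d → Bool, ∑ A : Fin n → Fin d → Fin N,
        ((Finset.univ.filter fun v : Fin d → Bool =>
          GuessesKey alg s γ A (Function.update V i.castSucc v) θ m i).card : ℝ)
        = 2 ^ d * ((Finset.univ.filter fun ω : (Fin n → Fin d → Fin N) ×
          (Fin (B + 1) → Fin d → Bool) => GuessesKey alg s γ ω.1 ω.2 θ m i).card : ℝ) := by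
      rw [Finset.sum_comm, Finset.card_filter, Fintype.sum_prod_type]
      push_cast
      rw [Finset.mul_sum]
      refine Finset.sum_congr rfl fun A _ => ?_
      rw [← hcX, ← sum_sum_update i.castSucc fun V : Fin (B + 1) → Fin d → Bool =>
        if GuessesKey alg s γ A V θ m i then (1 : ℝ) else 0]
      simp only [Finset.sum_boole]
    have h2 : ∑ _V : Fin (B + 1) → Fin d → Bool, (1 / 4 : ℝ) * cA * 2 ^ d
        ≤ ∑ V : Fin (B + 1) → Fin d → Bool, ∑ A : Fin n → Fin d → Fin N,
        ((Finset.univ.filter fun v : Fin d → Bool =>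
          GuessesKey alg s γ A (Function.update V i.castSucc v) θ m i).card : ℝ) := by
      rw [h1, Finset.sum_const, Finset.card_univ, nsmul_eq_mul]
      rw [Fintype.card_prod] at hi
      push_cast at hi
      have := mul_le_mul_of_nonneg_left hi (by positivity : (0 : ℝ) ≤ 2 ^ d)
      refine le_trans (le_of_eq ?_) this
      ring
    obtain ⟨V, _, hV⟩ := Finset.exists_le_of_sum_le Finset.univ_nonempty h2
    exact ⟨V, hV⟩
  set H : (Fin n → Fin d → Fin N) → Finset (Fin d → Bool) := fun A => Finset.univ.filter fun v =>
    GuessesKey alg s γ A (Function.update V i.castSucc v) θ m i with hH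
  set W : Finset (Fin n → Fin d → Fin N) :=
    Finset.univ.filter fun A => (1 / 8 : ℝ) * 2 ^ d ≤ (H A).card with hW
  have hWc : 1 / 8 * cA ≤ W.card := by
    have h1 : ∀ A, ((H A).card : ℝ)
        ≤ (if (1 / 8 : ℝ) * 2 ^ d ≤ (H A).card then 2 ^ d else 0) + 1 / 8 * 2 ^ d := by
      intro A
      have h2 : ((H A).card : ℝ) ≤ 2 ^ d := by
        rw [← hcX]; exact Nat.cast_le.mpr (Finset.card_le_univ _)
      split_ifs with h
      · have : (0 : ℝ) ≤ 1 / 8 * 2 ^ d := by positivity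
        linarith
      · linarith [not_le.mp h]
    have h3 : ∑ A, ((H A).card : ℝ) ≤ W.card * 2 ^ d + cA * (1 / 8 * 2 ^ d) := by
      refine (Finset.sum_le_sum fun A _ => h1 A).trans (le_of_eq ?_)
      rw [Finset.sum_add_distrib, ← Finset.sum_filter, Finset.sum_const, Finset.sum_const,
        Finset.card_univ, nsmul_eq_mul, nsmul_eq_mul]
    have h4 := hV.trans h3
    have h5 : (0 : ℝ) < 2 ^ d := by positivity
    refine le_of_mul_le_mul_right ?_ h5
    linarith
  have hupd : ∀ v : Fin d → Bool, ∀ j : Fin (B + 1), (j : ℕ) < i →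
      Function.update V i.castSucc v j = V j := fun v j hj => Function.update_of_ne (by
    rintro rfl
    simp at hj) _ _
  have hcore := card_mul_pow_le_of_cell_sampling hd hk hk0 hρ hσ hσρ
    (by positivity : 0 ≤ 4 * s * (N * d)) hτσ hρθ (q := 1 / (8 * L)) (b := b)
    (Λ := Fin T × Fin (m + 1) × {Q : Finset (Fin n) // Q.card = b}) (𝓜 := Memory S)
    (by
      simp only [Fintype.card_prod, Fintype.card_fin, Fintype.card_finset_len]
      push_cast
      rw [mul_one_div, div_le_div_iff₀ (by positivity) (by norm_num)]
      linarith)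
    (by
      refine hf.trans (le_of_eq ?_)
      field_simp
      norm_num)
    (fun α => α.2.2.1) (fun α => α.2.2.2)
    (fun α μ A v => alg.queryFrom (hardOracle s γ A (Function.update V i.castSucc v)
      (visiblePieces B α.2.2.1 (i + 1))) α.1 μ α.2.1)
    (fun α μ A A' hA v => by
      have hne : (visiblePieces B α.2.2.1 (i + 1)).Nonempty := ⟨.inr 0, by simp⟩
      rw [hardOracle_congr hne hA fun _ _ => rfl])
    (fun α μ A v => alg.norm_queryFrom_le _ _ _ _)
    (fun A α => alg.memoryFrom (hardOracle s γ A V (visiblePieces B ∅ i)) 0 alg.init α.1)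
    W H (fun A hA => (Finset.mem_filter.mp hA).2)
    (by
      intro A v hv
      obtain ⟨t₀, ht₀, u, hu, h1, h2⟩ := (Finset.mem_filter.mp hv).2
      rw [Function.update_self] at h1
      rw [hardOracle_congr (V' := V) (visiblePieces_empty_nonempty hn i) (fun _ _ => rfl)
        (hupd v)] at h1 h2
      set M₀ := alg.memoryFrom (hardOracle s γ A V (visiblePieces B ∅ i)) 0 alg.init t₀
      set V' := Function.update V i.castSucc v
      -- a row for each earlier query of the phase; it includes all rows met
      let met : ℕ → Fin n := fun u' => Sum.elim (fun p => p.1) (fun _ => ⟨0, hn⟩)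
        (activePiece (pieceOffset s γ) (visiblePieces B ∅ (i + 1)) (pieceGrad s A V')
          (alg.queryFrom (hardOracle s γ A V' (visiblePieces B ∅ (i + 1))) t₀ M₀ u'))
      have hfree : b ≤ ((Finset.range u).image met)ᶜ.card := by
        have h3 := Finset.card_image_le (s := Finset.range u) (f := met)
        rw [Finset.card_range] at h3
        rw [Finset.card_compl, Fintype.card_fin]
        omega
      obtain ⟨Q, hQ, hQc⟩ := Finset.exists_subset_card_eq hfree
      have hagree : alg.queryFrom (hardOracle s γ A V' (visiblePieces B Q (i + 1))) t₀ M₀ u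
          = alg.queryFrom (hardOracle s γ A V' (visiblePieces B ∅ (i + 1))) t₀ M₀ u := by
        refine alg.queryFrom_congr (U := u) (fun u' hu' => ?_) le_rfl
        refine maxAnswer_eq_of_subset ?_ ?_
        · rintro (p | j) hp
          · simp
          · simpa using hp
        · have hmem := firstMax_mem (visiblePieces_empty_nonempty hn (i + 1)) fun p =>
            inner ℝ (pieceGrad s A V' p) (alg.queryFrom (hardOracle s γ A V'
              (visiblePieces B ∅ (i + 1))) t₀ M₀ u') + pieceOffset s γ p
          change activePiece (pieceOffset s γ) (visiblePieces B ∅ (i + 1)) (pieceGrad s A V')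
            (alg.queryFrom (hardOracle s γ A V' (visiblePieces B ∅ (i + 1))) t₀ M₀ u') ∈ _ at hmem
          have hmet : met u' ∈ (Finset.range u).image met :=
            Finset.mem_image_of_mem _ (Finset.mem_range.mpr hu')
          rcases hp : activePiece (pieceOffset s γ) (visiblePieces B ∅ (i + 1)) (pieceGrad s A V')
            (alg.queryFrom (hardOracle s γ A V' (visiblePieces B ∅ (i + 1))) t₀ M₀ u')
            with p | j
          · have hmet' : met u' = p.1 := by simp only [met, hp, Sum.elim_inl]
            rw [hmet'] at hmet
            rw [inl_mem_visiblePieces]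
            exact fun hpQ => (Finset.mem_compl.mp (hQ hpQ)) hmet
          · rw [hp, inr_mem_visiblePieces] at hmem
            rwa [inr_mem_visiblePieces]
      refine ⟨(⟨t₀, ht₀⟩, ⟨u, by omega⟩, ⟨Q, hQc⟩), ?_, ?_⟩
      · simp only
        rw [hagree, le_abs]
        right
        linarith
      · intro r
        simp only
        rw [hagree, ← inner_rowVec]
        exact h2 r)
  have hΛ : ((Fintype.card (Fin T × Fin (m + 1) × {Q : Finset (Fin n) // Q.card = b}) : ℕ) : ℝ)
      ≤ L := by
    simp only [Fintype.card_prod, Fintype.card_fin, Fintype.card_finset_len]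
    exact_mod_cast hLc
  have hM : ((Fintype.card (Memory S) : ℕ) : ℝ) = 2 ^ S := by simp
  rw [hM, ← hcA] at hcore
  have h6 : 1 / 8 * cA * (1 / (8 * L) / 2) ^ (k₀ + k₀) * (N : ℝ) ^ (k₀ * b)
      ≤ L * 2 ^ S * cA := by
    refine le_trans ?_ (hcore.trans ?_)
    · gcongr
    · gcongr
  have h7 : (1 / (8 * L) / 2) ^ (k₀ + k₀) = 1 / (16 * L) ^ (k₀ + k₀) := by
    rw [div_div, one_div_pow]
    congr 2
    ring
  rw [h7] at h6
  have h8 : (0 : ℝ) < (16 * L) ^ (k₀ + k₀) := by positivity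
  have h9 : (N : ℝ) ^ (k₀ * b) / (16 * L) ^ (k₀ + k₀) ≤ 8 * L * 2 ^ S := by
    refine le_of_mul_le_mul_left ?_ hcA0
    calc cA * ((N : ℝ) ^ (k₀ * b) / (16 * L) ^ (k₀ + k₀))
        = 8 * (1 / 8 * cA * (1 / (16 * L) ^ (k₀ + k₀)) * (N : ℝ) ^ (k₀ * b)) := by ring
      _ ≤ 8 * (L * 2 ^ S * cA) := by linarith
      _ = _ := by ring
  rw [div_le_iff₀ h8] at h9
  linarith

/-- The trade-off between memory and queries, before the choice of parameters. -/
theorem pow_le_of_findsEpsOptimal {R : RandAlgorithm d S T} {s γ κ θ ε ρ σ L : ℝ}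
    {m b k₀ : ℕ} (N n B : ℕ) (hR : R.FindsEpsOptimal ε (2 / 3)) (hd : 0 < d) (hN : 0 < N)
    (hn : 0 < n) (hB : 0 < B) (hs : 0 < s) (hs1 : s ≤ 1) (hκ0 : 0 ≤ κ)
    (hκB : 8 * (B + 1) * κ ≤ 1) (hκγ : 2 * κ < γ) (hθ : κ - γ ≤ -θ) (hT : 2 * T ≤ B * m)
    (hbad : (B + 1) * (√2 ^ n * Real.exp (-(d * (3 / 16)))) +
        (B + 1) ^ 2 * (T + 2) * (√2 * Real.exp (-(d * κ ^ 2 / 4))) ≤ 1 / 6)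
    (hε : ε < s * (1 / (8 * √(2 * (B + 1))) - κ - B * γ))
    (hmb : m + b ≤ n) (hk : k₀ ≤ d) (hk0 : 0 < k₀)
    (hρ : 0 < ρ) (hσ : 0 < σ) (hσρ : σ * d ^ 2 < ρ ^ 2)
    (hτσ : 4 * d * (4 * s * (N * d)) < σ) (hρθ : ρ ≤ θ / 2) (hL : 0 < L)
    (hLc : (T * ((m + 1) * n.choose b) : ℝ) ≤ L)
    (hf : √2 ^ (k₀ + k₀) * Real.exp (-(d * θ ^ 2 / 16)) ≤ 1 / (16 * L)) :
    (N : ℝ) ^ (k₀ * b) ≤ 8 * L * (16 * L) ^ (k₀ + k₀) * 2 ^ S := by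
  obtain ⟨alg, W, hWc, hW⟩ := hR.exists_detAlgorithm
    (Ω := (Fin n → Fin d → Fin N) × (Fin (B + 1) → Fin d → Bool))
    (F := fun ω x => (hardOracle s γ ω.1 ω.2 Finset.univ x).1)
    (g := fun ω x => (hardOracle s γ ω.1 ω.2 Finset.univ x).2)
    (fun ω => isConvexLipschitz_maxAnswer _ (norm_pieceGrad_le hs.le hs1 ω.1 ω.2))
    (fun ω => isSubgradientOracle_maxAnswer _ (norm_pieceGrad_le hs.le hs1 ω.1 ω.2))
  obtain ⟨i, hi⟩ := exists_le_card_guessesKey alg hd hN hn hB hs hκ0 hκB hκγ hθ hT hbad hε W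
    hWc hW
  exact pow_le_of_guessesKey alg hd hN hn hs hmb hk hk0 hρ hσ hσρ hτσ hρθ hL hLc hf i hi

end Finite

/-! ### The choice of parameters -/

/-- The number of labels, with its power from the choice of `b + b` sign vectors, and the number of
memory contents are together less than the factor `N ^ (b * b)` lost by the rows, for `x = d` and
`N = d ^ 16`. -/
lemma mul_pow_mul_two_pow_lt {x : ℝ} (hx : 32 < x) {b S : ℕ} (hb : 2 ≤ b) (hS : S ≤ b * b) :
    8 * x ^ (b + 3) * (16 * x ^ (b + 3)) ^ (b + b) * 2 ^ S < (x ^ 16) ^ (b * b) := by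
  have h1 : (2 : ℝ) ^ S ≤ x ^ (b * b) :=
    (pow_le_pow_right₀ one_le_two hS).trans (pow_le_pow_left₀ (by norm_num) (by linarith) _)
  have h2 : 16 * x ^ (b + 3) ≤ x ^ (b + 4) := by
    rw [pow_succ x (b + 3), mul_comm]
    exact mul_le_mul_of_nonneg_left (by linarith) (by positivity)
  have h3 : 8 * x ^ (b + 3) ≤ x ^ (b + 4) := by
    have : 0 < x ^ (b + 3) := by positivity
    linarith
  calc 8 * x ^ (b + 3) * (16 * x ^ (b + 3)) ^ (b + b) * 2 ^ S
      ≤ x ^ (b + 4) * (x ^ (b + 4)) ^ (b + b) * x ^ (b * b) :=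
        mul_le_mul (mul_le_mul h3 (pow_le_pow_left₀ (by positivity) h2 _) (by positivity)
          (by positivity)) h1 (by positivity) (by positivity)
    _ = x ^ (b + 4 + (b + 4) * (b + b) + b * b) := by rw [← pow_mul, ← pow_add, ← pow_add]
    _ < x ^ (16 * (b * b)) := pow_lt_pow_right₀ (by linarith) (by nlinarith)
    _ = (x ^ 16) ^ (b * b) := by rw [pow_mul]

set_option maxHeartbeats 1000000 in
/-- The trade-off in terms of the number `p` of keys and the number `q` of unmet rows, which is also
half the number of robustly independent points. -/
lemma not_findsEpsOptimal {d S T : ℕ} {p q : ℝ} (hp : 1 ≤ p) (hq : 1 < q)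
    (hpq : p ^ 3 * q * Real.log d ^ 3 = d) (hqd : 32 * q ≤ d) (hl : 3000 ≤ Real.log d)
    (hexp : (d : ℝ) * Real.exp (-(d / 16)) ≤ 1 / 12) (hS : (S : ℝ) ≤ q ^ 2)
    (hT : 64 * (T : ℝ) ≤ d * p) (R : RandAlgorithm d S T) :
    ¬R.FindsEpsOptimal (Real.exp (-(Real.log (d : ℝ)) ^ 5)) (2 / 3) := by
  intro hR
  set l := Real.log d with hl_def
  have hd32 : (32 : ℝ) < d := by linarith
  have hd0 : (0 : ℝ) < d := by linarith
  have hd1 : 32 < d := by exact_mod_cast hd32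
  have hld : Real.exp l = d := Real.exp_log hd0
  -- integer parameters
  set B := ⌊p⌋₊ with hB_def
  set b := ⌈q⌉₊ with hb_def
  have hBp : (B : ℝ) ≤ p := Nat.floor_le (by linarith)
  have hB1 : 1 ≤ B := Nat.one_le_floor_iff p |>.mpr hp
  have hB1' : (1 : ℝ) ≤ B := by exact_mod_cast hB1
  have hpB : p < B + 1 := Nat.lt_floor_add_one p
  have hqb : q ≤ b := Nat.le_ceil q
  have hbq : (b : ℝ) < q + 1 := Nat.ceil_lt_add_one (by linarith)
  have hb2 : 2 ≤ b := by
    have : (1 : ℝ) < b := hq.trans_le hqb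
    exact_mod_cast this
  have hb2' : (2 : ℝ) ≤ b := by exact_mod_cast hb2
  have h16b : 16 * b ≤ d := by
    have : (16 : ℝ) * b ≤ d := by linarith
    exact_mod_cast this
  have hl3 : (3000 : ℝ) ≤ l ^ 3 := hl.trans (le_self_pow₀ (by linarith) (by norm_num))
  have hpd : 3000 * p ≤ d := by
    have h1 : p ≤ p ^ 3 := le_self_pow₀ hp (by norm_num)
    have h2 : p ≤ p ^ 3 * q := by nlinarith
    have h3 : p * l ^ 3 ≤ d := by
      rw [← hpq]; exact mul_le_mul_of_nonneg_right h2 (by positivity)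
    nlinarith
  have hTd : (T : ℝ) + 2 ≤ d ^ 2 := by nlinarith
  have hBd : (B : ℝ) + 1 ≤ d := by linarith
  -- the correlation thresholds
  set θ := 8 * √(b * l / d) with hθ_def
  have hθ2 : θ ^ 2 = 64 * (b * l / d) := by
    rw [hθ_def, mul_pow, Real.sq_sqrt (by positivity)]; norm_num
  have hθ0 : 0 < θ := by positivity
  have hdθ : d * θ ^ 2 = 64 * (b * l) := by rw [hθ2]; field_simp
  have hBθ : (B + 1) ^ 3 * θ ^ 2 * 4608 ≤ 1 := by
    have h1 : ((B : ℝ) + 1) ^ 3 ≤ (2 * p) ^ 3 := pow_le_pow_left₀ (by positivity) (by linarith) 3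
    have h2 : θ ^ 2 ≤ 128 * (q * l / d) := by
      rw [hθ2, show 128 * (q * l / d) = 64 * (2 * q * l / d) by ring]
      gcongr
      linarith
    have h3 : ((B : ℝ) + 1) ^ 3 * θ ^ 2 ≤ (2 * p) ^ 3 * (128 * (q * l / d)) := by gcongr
    have h4 : (2 * p) ^ 3 * (128 * (q * l / d)) = 1024 / l ^ 2 := by
      rw [← hpq]
      have hl0 : l ≠ 0 := by linarith
      have hp0 : p ≠ 0 := by linarith
      have hq0 : q ≠ 0 := by linarith
      field_simp
      norm_num
    rw [h4] at h3
    have h5 : 1024 / l ^ 2 * 4608 ≤ 1 := by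
      rw [div_mul_eq_mul_div, div_le_one (by positivity)]
      nlinarith
    linarith
  have hsqrt : 3 * (B + 1) * θ ≤ 1 / (16 * √(2 * (B + 1))) := by
    rw [le_div_iff₀ (by positivity)]
    refine le_of_sq_le_sq ?_ zero_le_one
    have h1 : √(2 * ((B : ℝ) + 1)) ^ 2 = 2 * (B + 1) := Real.sq_sqrt (by positivity)
    calc (3 * (B + 1) * θ * (16 * √(2 * ((B : ℝ) + 1)))) ^ 2
        = 2304 * (B + 1) ^ 2 * θ ^ 2 * √(2 * ((B : ℝ) + 1)) ^ 2 := by ring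
      _ = (B + 1) ^ 3 * θ ^ 2 * 4608 := by rw [h1]; ring
      _ ≤ 1 ^ 2 := by linarith
  have hsq2 : (2 : ℝ) ≤ √(2 * (B + 1)) := Real.le_sqrt_of_sq_le (by linarith)
  have hsqd : √(2 * ((B : ℝ) + 1)) ≤ d := by
    refine Real.sqrt_le_iff.mpr ⟨hd0.le, ?_⟩
    nlinarith
  have hL := pow_le_of_findsEpsOptimal (R := R) (s := 1 / (d : ℝ) ^ 24) (γ := 3 * θ) (κ := θ)
    (θ := θ) (ρ := 1 / d) (σ := 1 / (d : ℝ) ^ 5) (L := (d : ℝ) ^ (b + 3)) (m := d / 8) (b := b)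
    (k₀ := b) (d ^ 16) (d / 4) B hR (by omega) (by positivity) (by omega) (by omega)
    (by positivity) ?_ hθ0.le ?_ (by linarith) (by linarith) ?_ ?_ ?_ (by omega) (by omega)
    (by omega) (by positivity) (by positivity) ?_ ?_ ?_ (by positivity) ?_ ?_
  · -- the final comparison: `16 * b ^ 2` exceeds the exponent on the right
    have hS2 : (S : ℝ) ≤ (b * b : ℕ) := by
      rw [Nat.cast_mul, ← pow_two]
      exact hS.trans (pow_le_pow_left₀ (by linarith) hqb 2)
    rw [Nat.cast_pow] at hL
    exact absurd hL (not_le.mpr (mul_pow_mul_two_pow_lt hd32 hb2 (by exact_mod_cast hS2)))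
  · rw [div_le_one (by positivity)]
    exact one_le_pow₀ (by linarith)
  · have h1 : (1 : ℝ) / (16 * √(2 * (B + 1))) ≤ 1 / 32 :=
      one_div_le_one_div_of_le (by norm_num) (by linarith)
    linarith
  · have h1 : d < 16 * (d / 8) := by omega
    have h2 : (d : ℝ) < 16 * ((d / 8 : ℕ) : ℝ) := by exact_mod_cast h1
    have h3 : 2 * (T : ℝ) ≤ B * ((d / 8 : ℕ) : ℝ) := by
      have h4 : p ≤ 2 * B := by linarith
      nlinarith
    exact_mod_cast h3
  · have h1 : √2 ^ (d / 4) ≤ Real.exp (d * (1 / 8)) := by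
      have h2 : √2 ≤ Real.exp (1 / 2) := by
        refine Real.sqrt_le_iff.mpr ⟨by positivity, ?_⟩
        rw [← Real.exp_nat_mul]
        have := Real.add_one_le_exp (((2 : ℕ) : ℝ) * (1 / 2))
        norm_num at this ⊢
        linarith
      calc √2 ^ (d / 4) ≤ Real.exp (1 / 2) ^ (d / 4) := pow_le_pow_left₀ (by positivity) h2 _
        _ = Real.exp ((d / 4 : ℕ) * (1 / 2)) := (Real.exp_nat_mul _ _).symm
        _ ≤ _ := by
          refine Real.exp_le_exp.mpr ?_
          have : ((d / 4 : ℕ) : ℝ) ≤ d / 4 := Nat.cast_div_le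
          linarith
    have h2 : ((B : ℝ) + 1) * (√2 ^ (d / 4) * Real.exp (-(d * (3 / 16)))) ≤ 1 / 12 := by
      refine le_trans ?_ hexp
      refine mul_le_mul hBd ?_ (by positivity) hd0.le
      refine (mul_le_mul_of_nonneg_right h1 (Real.exp_pos _).le).trans (le_of_eq ?_)
      rw [← Real.exp_add]
      congr 1
      ring
    have h3 : Real.exp (-(d * θ ^ 2 / 4)) ≤ 1 / (d : ℝ) ^ 6 := by
      rw [hdθ, Real.exp_neg, ← one_div]
      refine one_div_le_one_div_of_le (by positivity) ?_
      rw [← hld, ← Real.exp_nat_mul]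
      refine Real.exp_le_exp.mpr ?_
      push_cast
      nlinarith
    have h4 : √2 ≤ 2 := Real.sqrt_le_iff.mpr ⟨by norm_num, by norm_num⟩
    have h5 : ((B : ℝ) + 1) ^ 2 * (T + 2) * (√2 * Real.exp (-(d * θ ^ 2 / 4))) ≤ 1 / 12 := by
      calc ((B : ℝ) + 1) ^ 2 * (T + 2) * (√2 * Real.exp (-(d * θ ^ 2 / 4)))
          ≤ (d : ℝ) ^ 2 * d ^ 2 * (2 * (1 / (d : ℝ) ^ 6)) := by gcongr
        _ = 2 / (d : ℝ) ^ 2 := by field_simp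
        _ ≤ 1 / 12 := by
          rw [div_le_div_iff₀ (by positivity) (by norm_num)]
          nlinarith
    linarith
  · -- `ε` is much smaller than the scale of the keys
    have h1 : Real.exp (-l ^ 5) ≤ 1 / (d : ℝ) ^ 27 := by
      rw [Real.exp_neg, ← one_div]
      refine one_div_le_one_div_of_le (by positivity) ?_
      rw [← hld, ← Real.exp_nat_mul]
      refine Real.exp_le_exp.mpr ?_
      push_cast
      have h2 : (27 : ℝ) ≤ l ^ 4 := by
        have : l ≤ l ^ 4 := le_self_pow₀ (by linarith) (by norm_num)
        linarith
      calc (27 : ℝ) * l ≤ l ^ 4 * l := by gcongr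
        _ = l ^ 5 := by ring
    have h2 : (1 : ℝ) / (16 * d) ≤ 1 / (8 * √(2 * (B + 1))) - θ - B * (3 * θ) := by
      have h3 : (1 : ℝ) / (16 * d) ≤ 1 / (16 * √(2 * (B + 1))) :=
        one_div_le_one_div_of_le (by positivity) (by linarith)
      have h4 : (1 : ℝ) / (8 * √(2 * (B + 1))) = 2 * (1 / (16 * √(2 * (B + 1)))) := by
        field_simp; norm_num
      rw [h4]
      linarith
    have h3 : (1 : ℝ) / d ^ 24 * (1 / (16 * d)) = 1 / (16 * d ^ 25) := by
      field_simp
    have h4 : (1 : ℝ) / d ^ 27 < 1 / (16 * d ^ 25) := by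
      refine one_div_lt_one_div_of_lt (by positivity) ?_
      have h5 : (0 : ℝ) < d ^ 25 := by positivity
      have h6 : (16 : ℝ) < d ^ 2 := by nlinarith
      calc 16 * (d : ℝ) ^ 25 < d ^ 2 * d ^ 25 := mul_lt_mul_of_pos_right h6 h5
        _ = d ^ 27 := by ring
    have h5 := mul_le_mul_of_nonneg_left h2 (by positivity : (0 : ℝ) ≤ 1 / (d : ℝ) ^ 24)
    rw [h3] at h5
    linarith
  · rw [one_div_mul_eq_div, one_div_pow]
    have : (d : ℝ) ^ 2 / d ^ 5 = 1 / d ^ 3 := by field_simp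
    rw [this]
    refine one_div_lt_one_div_of_lt (by positivity) ?_
    exact pow_lt_pow_right₀ (by linarith) (by norm_num)
  · push_cast
    have : 4 * (d : ℝ) * (4 * (1 / (d : ℝ) ^ 24) * ((d : ℝ) ^ 16 * d)) = 16 / d ^ 6 := by
      field_simp; norm_num
    rw [this, div_lt_div_iff₀ (by positivity) (by positivity)]
    have h5 : (0 : ℝ) < d ^ 5 := by positivity
    nlinarith
  · refine le_of_sq_le_sq ?_ (by positivity)
    rw [div_pow, div_pow, hθ2, div_le_div_iff₀ (by positivity) (by norm_num)]
    have : 64 * (b * l / d) * (d : ℝ) ^ 2 = 64 * (b * l) * d := by field_simp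
    rw [this]
    have : (2 : ℝ) * 3000 ≤ b * l := mul_le_mul hb2' hl (by norm_num) (by positivity)
    nlinarith
  · have h1 : ((d / 4).choose b : ℝ) ≤ (d : ℝ) ^ b := by
      have : (d / 4).choose b ≤ d ^ b :=
        (Nat.choose_le_pow _ _).trans (Nat.pow_le_pow_left (Nat.div_le_self _ _) _)
      exact_mod_cast this
    have h2 : ((d / 8 : ℕ) : ℝ) + 1 ≤ d := by
      have : d / 8 + 1 ≤ d := by omega
      exact_mod_cast this
    calc (T : ℝ) * ((((d / 8 : ℕ) : ℝ) + 1) * (d / 4).choose b)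
        ≤ (d : ℝ) ^ 2 * (d * (d : ℝ) ^ b) := by
          gcongr
          linarith
      _ = (d : ℝ) ^ (b + 3) := by ring
  · have h1 : √2 ^ (b + b) ≤ Real.exp b := by
      rw [← two_mul, pow_mul, Real.sq_sqrt (by norm_num)]
      have := Real.add_one_le_exp (1 : ℝ)
      calc (2 : ℝ) ^ b ≤ Real.exp 1 ^ b := pow_le_pow_left₀ (by norm_num) (by linarith) _
        _ = Real.exp b := by rw [← Real.exp_nat_mul, mul_one]
    calc √2 ^ (b + b) * Real.exp (-(d * θ ^ 2 / 16))
        ≤ Real.exp b * Real.exp (-(d * θ ^ 2 / 16)) := by gcongr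
      _ = Real.exp (-(4 * (b * l) - b)) := by
          rw [← Real.exp_add, hdθ]; congr 1; ring
      _ ≤ Real.exp (-(((b + 4 : ℕ) : ℝ) * l)) := by
          refine Real.exp_le_exp.mpr ?_
          push_cast
          nlinarith
      _ = 1 / (d : ℝ) ^ (b + 4) := by
          rw [Real.exp_neg, Real.exp_nat_mul, hld, one_div]
      _ ≤ 1 / (16 * (d : ℝ) ^ (b + 3)) := by
          refine one_div_le_one_div_of_le (by positivity) ?_
          rw [pow_succ (d : ℝ) (b + 3), mul_comm]
          exact mul_le_mul_of_nonneg_left (by linarith) (by positivity)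

/-- The trade-off with `η_d = log (log d) / log d`: the keys number about `d ^ (δ / 6) / log d`. -/
lemma eventually_le_or_le_of_findsEpsOptimal (δ : ℝ) (hδ0 : 0 < δ) (hδ1 : δ < 1) :
    ∃ c : ℝ, 0 < c ∧ ∃ η : ℕ → ℝ, Tendsto η atTop (𝓝 0) ∧
      ∀ᶠ d : ℕ in atTop, ∀ (S T : ℕ) (R : RandAlgorithm d S T),
        R.FindsEpsOptimal (Real.exp (-(Real.log (d : ℝ)) ^ 5)) (2 / 3) →
          c * (d : ℝ) ^ (2 - δ) ≤ (S : ℝ) ∨ c * (d : ℝ) ^ (1 + δ / 6 - η d) ≤ (T : ℝ) := by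
  have hcast : Tendsto (fun d : ℕ => (d : ℝ)) atTop atTop := tendsto_natCast_atTop_atTop
  have hlog : Tendsto (fun d : ℕ => Real.log d) atTop atTop := Real.tendsto_log_atTop.comp hcast
  refine ⟨1 / 64, by norm_num, fun d => Real.log (Real.log d) / Real.log d, ?_, ?_⟩
  · exact (Real.isLittleO_log_id_atTop.tendsto_div_nhds_zero).comp hlog
  have e1 : ∀ᶠ d : ℕ in atTop, Real.log d ≤ (d : ℝ) ^ (δ / 6) := by
    have h := (isLittleO_log_rpow_atTop (by positivity : 0 < δ / 6)).bound one_pos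
    filter_upwards [hcast.eventually h, hcast.eventually_ge_atTop 1] with d hd hd1
    rw [one_mul, Real.norm_eq_abs, Real.norm_eq_abs,
      abs_of_nonneg (Real.rpow_nonneg (by linarith) _)] at hd
    exact (le_abs_self _).trans hd
  have e2 : ∀ᶠ d : ℕ in atTop, (32 : ℝ) ≤ (d : ℝ) ^ (δ / 2) :=
    ((tendsto_rpow_atTop (by positivity : 0 < δ / 2)).comp hcast).eventually_ge_atTop 32
  have e3 : ∀ᶠ d : ℕ in atTop, (d : ℝ) * Real.exp (-(d / 16)) ≤ 1 / 12 := by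
    have h := (Real.tendsto_pow_mul_exp_neg_atTop_nhds_zero 1).comp
      ((tendsto_id.atTop_div_const (by norm_num : (0 : ℝ) < 16)).comp hcast)
    filter_upwards [h.eventually (gt_mem_nhds (by norm_num : (0 : ℝ) < 1 / 192))] with d hd
    simp only [Function.comp_apply, id, pow_one] at hd
    linarith
  filter_upwards [e1, e2, e3, hlog.eventually_ge_atTop 3000, eventually_gt_atTop 1]
    with d h1 h2 h3 h4 h5 S T R hR
  by_contra! hcon
  obtain ⟨hS, hT⟩ := hcon
  have hd : (0 : ℝ) < d := by positivity
  have hd1 : (1 : ℝ) < d := by exact_mod_cast h5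
  have hl : 0 < Real.log d := by linarith
  refine not_findsEpsOptimal (p := (d : ℝ) ^ (δ / 6) / Real.log d) (q := (d : ℝ) ^ (1 - δ / 2))
    ?_ ?_ ?_ ?_ h4 h3 ?_ ?_ R hR
  · rwa [one_le_div hl]
  · exact Real.one_lt_rpow hd1 (by linarith)
  · rw [div_pow, ← Real.rpow_natCast, ← Real.rpow_mul hd.le]
    have : (d : ℝ) ^ (δ / 6 * (3 : ℕ)) * (d : ℝ) ^ (1 - δ / 2) = d := by
      rw [← Real.rpow_add hd]
      convert Real.rpow_one (d : ℝ) using 2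
      push_cast; ring
    rw [div_mul_eq_mul_div, div_mul_cancel₀ _ (by positivity)]
    exact this
  · have : (d : ℝ) ^ (1 - δ / 2) * (d : ℝ) ^ (δ / 2) = d := by
      rw [← Real.rpow_add hd, sub_add_cancel, Real.rpow_one]
    have h6 : 0 < (d : ℝ) ^ (1 - δ / 2) := by positivity
    nlinarith
  · rw [← Real.rpow_natCast, ← Real.rpow_mul hd.le]
    have : (1 - δ / 2) * ((2 : ℕ) : ℝ) = 2 - δ := by push_cast; ring
    rw [this]
    have h6 : 0 < (d : ℝ) ^ (2 - δ) := by positivity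
    linarith
  · have h6 : (d : ℝ) ^ (1 + δ / 6 - Real.log (Real.log d) / Real.log d)
        = d * ((d : ℝ) ^ (δ / 6) / Real.log d) := by
      rw [Real.rpow_sub hd, Real.rpow_add hd, Real.rpow_one]
      have : (d : ℝ) ^ (Real.log (Real.log d) / Real.log d) = Real.log d := by
        rw [Real.rpow_def_of_pos hd, mul_div_cancel₀ _ hl.ne', Real.exp_log hl]
      rw [this]
      ring
    rw [h6] at hT
    linarith

theorem theorem1 (δ : ℝ) (hδ0 : 0 < δ) (hδ1 : δ < 1) :
    (∃ c : ℝ, 0 < c ∧ ∃ η : ℕ → ℝ, Tendsto η atTop (𝓝 0) ∧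
      ∀ᶠ d : ℕ in atTop, ∀ (S T : ℕ) (R : RandAlgorithm d S T),
        R.FindsEpsOptimal (Real.exp (-(Real.log (d : ℝ)) ^ 5)) (2 / 3) →
          c * (d : ℝ) ^ (2 - δ) ≤ (S : ℝ) ∨ c * (d : ℝ) ^ (1 + δ / 6 - η d) ≤ (T : ℝ)) ∧
    (∀ β : ℕ → ℝ, Tendsto β atTop (𝓝 0) →
      ∀ᶠ d : ℕ in atTop, ∀ (S T : ℕ) (R : RandAlgorithm d S T),
        R.FindsEpsOptimal (Real.exp (-(Real.log (d : ℝ)) ^ 5)) (2 / 3) →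
          (T : ℝ) ≤ (d : ℝ) ^ (1 + β d) → (d : ℝ) ^ (2 - δ) ≤ (S : ℝ)) := by
  refine ⟨eventually_le_or_le_of_findsEpsOptimal δ hδ0 hδ1, fun β hβ => ?_⟩
  -- the first part for `δ / 2` leaves room to absorb the constant
  obtain ⟨c, hc, η, hη, h⟩ :=
    eventually_le_or_le_of_findsEpsOptimal (δ / 2) (by positivity) (by linarith)
  have hcast : Tendsto (fun d : ℕ => (d : ℝ)) atTop atTop := tendsto_natCast_atTop_atTop
  have e1 : ∀ᶠ d : ℕ in atTop, 1 / c < (d : ℝ) ^ (δ / 24) :=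
    ((tendsto_rpow_atTop (by positivity : 0 < δ / 24)).comp hcast).eventually_gt_atTop _
  have e2 : ∀ᶠ d : ℕ in atTop, η d + β d < δ / 24 := by
    have := hη.add hβ
    rw [add_zero] at this
    exact this.eventually (gt_mem_nhds (by positivity))
  filter_upwards [h, e1, e2, eventually_gt_atTop 1] with d hd h1 h2 h3 S T R hR hT
  have hd1 : (1 : ℝ) < d := by exact_mod_cast h3
  have hd0 : (0 : ℝ) < d := by linarith
  rw [div_lt_iff₀ hc, mul_comm] at h1
  -- a gain of `δ / 24` in the exponent beats the constant
  have key : ∀ a a' : ℝ, a + δ / 24 ≤ a' → (d : ℝ) ^ a < c * (d : ℝ) ^ a' := by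
    intro a a' haa
    have h4 : (d : ℝ) ^ (a + δ / 24) ≤ (d : ℝ) ^ a' := Real.rpow_le_rpow_of_exponent_le hd1.le haa
    rw [Real.rpow_add hd0] at h4
    have h5 : 0 < (d : ℝ) ^ a := by positivity
    calc (d : ℝ) ^ a < (d : ℝ) ^ a * (c * (d : ℝ) ^ (δ / 24)) := lt_mul_of_one_lt_right h5 h1
      _ = c * ((d : ℝ) ^ a * (d : ℝ) ^ (δ / 24)) := by ring
      _ ≤ _ := mul_le_mul_of_nonneg_left h4 hc.le
  rcases hd S T R hR with h4 | h4
  · exact (key (2 - δ) (2 - δ / 2) (by linarith)).le.trans h4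
  · exact absurd (h4.trans hT) (not_le.mpr (key _ _ (by linarith)))
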